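/- Let $K$ be a field of characteristic zero and let $A_n(K)$ be the Weyl algebra of differential operators on $K[x_1,\dots,x_n]$ generated by $x_1,\dots,x_n$ and $\partial_1,\dots,\partial_n$, where $\partial_i=\partial/\partial x_i$. Let the set of variables $\{x_1,\dots,x_n\}$ be partitioned into $p$ blocks of sizes $n_1,\dots,n_p\ge 0$, so that $n_1+\dots+n_p=n$. The $j$-th order of a monomial $x^\alpha\partial^\beta$ is the sum of $\alpha_k+\beta_k$ over all $k$ such that $x_k$ lies in the $j$-th block. For $(r_1,\dots,r_p)\in\mathbb Z^p$, let $W_{r_1,\dots,r_p}$ be the $K$-linear span of all monomials $x^\alpha\partial^\beta$ whose $j$-th order is at most $r_j$ for every $j$. Let $M$ be a nonzero left $A_n(K)$-module generated by $f_1,\dots,f_m$, and put $M_{r_1,\dots,r_p}=\sum_{i=1}^m W_{r_1,\dots,r_p}f_i$. Then there is a nonzero polynomial $\phi_M\in\mathbb Q[t_1,\dots,t_p]$ which is numerical (it takes integer values at all sufficiently large integer points $(r_1,\dots,r_p)$, i.e. there is $s\in\mathbb Z^p$ such that this holds whenever $r_i\ge s_i$ for all $i$) and has the following properties. (i) For all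 sufficiently large $(r_1,\dots,r_p)\in\mathbb Z^p$, the space $M_{r_1,\dots,r_p}$ is finite-dimensional over $K$ and $\phi_M(r_1,\dots,r_p)=\dim_K M_{r_1,\dots,r_p}$. (ii) $n_i\le\deg_{t_i}\phi_M\le 2n_i$ for $1\le i\le p$; the total degree satisfies $n\le\deg\phi_M\le 2n$; and $$\phi_M(t_1,\dots,t_p)=\sum_{i_1=0}^{2n_1}\dots\sum_{i_p=0}^{2n_p}a_{i_1\dots i_p}\binom{t_1+i_1}{i_1}\cdots\binom{t_p+i_p}{i_p}$$ for some integers $a_{i_1\dots i_p}$, where $\binom{t+k}{k}=\frac{(t+1)\cdots(t+k)}{k!}$. (iii) $M$ is holonomic if and only if $\deg\phi_M=n$. Here $M$ is called holonomic if it has a finite system of generators $g_1,\dots,g_q$ whose Bernstein polynomial has degree $n$; the Bernstein polynomial is the polynomial $\psi\in\mathbb Q[t]$ with $\psi(r)=\dim_K\sum_{i=1}^q W_r g_i$ for all sufficiently large integers $r$, where $W_r$ is the $K$-span of the monomials $x^\alpha\partial^\beta$ with $|\alpha|+|\beta|\le r$. -/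

import Mathlib

noncomputable section

/-- The Weyl algebra `A_n(K)`, as the `K`-algebra of differential operators on `K[x_1, …, x_n]`
generated by the multiplications by the variables and the partial differentiations
(`K` is a field of characteristic zero wherever this is used). -/
def weylSubalgebra (K : Type*) [Field K] (n : ℕ) :
    Subalgebra K (Module.End K (MvPolynomial (Fin n) K)) :=
  Algebra.adjoin K
    (Set.range (fun k : Fin n => LinearMap.mulLeft K (MvPolynomial.X k : MvPolynomial (Fin n) K)) ∪
      Set.range (fun k : Fin n =>
        ((MvPolynomial.pderiv k : Derivation K (MvPolynomial (Fin n) K) (MvPolynomial (Fin n) K)) :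
          MvPolynomial (Fin n) K →ₗ[K] MvPolynomial (Fin n) K)))

/-- The Weyl algebra as a type; a `D`-module is a (left) module over it. -/
abbrev WeylAlgebra (K : Type*) [Field K] (n : ℕ) : Type _ := ↥(weylSubalgebra K n)

namespace WeylAlgebra

variable (K : Type*) [Field K] {n : ℕ}

/-- The generator `x_k`: multiplication by the `k`-th variable. -/
def x (k : Fin n) : WeylAlgebra K n :=
  ⟨LinearMap.mulLeft K (MvPolynomial.X k : MvPolynomial (Fin n) K),
    Algebra.subset_adjoin (Or.inl ⟨k, rfl⟩)⟩

/-- The generator `∂_k`: partial differentiation with respect to the `k`-th variable. -/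
def d (k : Fin n) : WeylAlgebra K n :=
  ⟨((MvPolynomial.pderiv k : Derivation K (MvPolynomial (Fin n) K) (MvPolynomial (Fin n) K)) :
      MvPolynomial (Fin n) K →ₗ[K] MvPolynomial (Fin n) K),
    Algebra.subset_adjoin (Or.inr ⟨k, rfl⟩)⟩

/-- The monomial `x^α ∂^β = x_1^{α_1} ⋯ x_n^{α_n} ∂_1^{β_1} ⋯ ∂_n^{β_n}`. -/
def monomial (α β : Fin n → ℕ) : WeylAlgebra K n :=
  (List.ofFn fun k => x K k ^ α k).prod * (List.ofFn fun k => d K k ^ β k).prod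

/-- The order `|α| + |β|` of the monomial `x^α ∂^β`. -/
def ord (α β : Fin n → ℕ) : ℕ := ∑ k, (α k + β k)

/-- For a partition of the variables into `p` blocks, given by the map `b` that sends the index of
a variable to the index of its block, the `j`-th order `∑_{k in block j} (α_k + β_k)` of the
monomial `x^α ∂^β`. -/
def blockOrd {p : ℕ} (b : Fin n → Fin p) (j : Fin p) (α β : Fin n → ℕ) : ℕ :=
  ∑ k with b k = j, (α k + β k)

/-- The Bernstein filtration: `W_r` is spanned over `K` by the monomials of order at most `r`
(so it is `0` for `r < 0`). -/
def bernsteinW (n : ℕ) (r : ℤ) : Submodule K (WeylAlgebra K n) :=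
  Submodule.span K {D | ∃ α β : Fin n → ℕ, (ord α β : ℤ) ≤ r ∧ D = monomial K α β}

/-- The `p`-dimensional filtration: `W_{r_1,…,r_p}` is spanned over `K` by the monomials whose
`j`-th order is at most `r_j` for every `j` (so it is `0` if some `r_j` is negative). -/
def multiW {p : ℕ} (b : Fin n → Fin p) (r : Fin p → ℤ) : Submodule K (WeylAlgebra K n) :=
  Submodule.span K
    {D | ∃ α β : Fin n → ℕ, (∀ j, (blockOrd b j α β : ℤ) ≤ r j) ∧ D = monomial K α β}

variable {M : Type*} [AddCommGroup M] [Module (WeylAlgebra K n) M] [Module K M]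
  [IsScalarTower K (WeylAlgebra K n) M]

/-- For a `K`-subspace `W` of `A_n(K)` and `f_1, …, f_m ∈ M`, the `K`-subspace `∑_i W f_i`. -/
def sumSmul {m : ℕ} (W : Submodule K (WeylAlgebra K n)) (f : Fin m → M) : Submodule K M :=
  ⨆ i, W.map ((LinearMap.toSpanSingleton (WeylAlgebra K n) M (f i)).restrictScalars K)

/-- `M_{r_1,…,r_p} = ∑_i W_{r_1,…,r_p} f_i`. -/
def multiM {p m : ℕ} (b : Fin n → Fin p) (f : Fin m → M) (r : Fin p → ℤ) : Submodule K M :=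
  sumSmul K (multiW K b r) f

/-- `ψ` is the Bernstein polynomial of the module with respect to `g_1, …, g_m`:
`ψ(r) = dim_K (∑_i W_r g_i)` for all sufficiently large integers `r`. -/
def IsBernsteinPolynomial {m : ℕ} (g : Fin m → M) (ψ : Polynomial ℚ) : Prop :=
  ∃ r₀ : ℤ, ∀ r : ℤ, r₀ ≤ r →
    ψ.eval (r : ℚ) = (Module.finrank K ↥(sumSmul K (bernsteinW K n r) g) : ℚ)

variable (n M) in
/-- `M` is holonomic (belongs to the Bernstein class): it is finitely generated, and the Bernstein
polynomial associated with a finite system of generators has degree `n`. -/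
def IsHolonomic : Prop :=
  ∃ (m : ℕ) (g : Fin m → M), Submodule.span (WeylAlgebra K n) (Set.range g) = ⊤ ∧
    ∃ ψ : Polynomial ℚ, IsBernsteinPolynomial K (n := n) g ψ ∧ ψ.degree = (n : WithBot ℕ)

end WeylAlgebra

/-- A polynomial over `ℚ` in `p` variables is numerical if its values at all sufficiently large
integer points are integers. -/
def IsNumerical {p : ℕ} (φ : MvPolynomial (Fin p) ℚ) : Prop :=
  ∃ s : Fin p → ℤ, ∀ r : Fin p → ℤ, s ≤ r →
    ∃ z : ℤ, MvPolynomial.eval (fun i => (r i : ℚ)) φ = (z : ℚ)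

/-- The polynomial `binom (t_i + k) k = (t_i + 1) ⋯ (t_i + k) / k!` in `ℚ[t_1, …, t_p]`. -/
def binomPoly {p : ℕ} (i : Fin p) (k : ℕ) : MvPolynomial (Fin p) ℚ :=
  MvPolynomial.C ((k.factorial : ℚ)⁻¹) *
    ∏ j ∈ Finset.range k, (MvPolynomial.X i + MvPolynomial.C ((j : ℚ) + 1))

/-- The size of the `i`-th block of a partition given by its block map. -/
def blockSize {n p : ℕ} (b : Fin n → Fin p) (i : Fin p) : ℕ :=
  (Finset.univ.filter fun k => b k = i).card

end

/-! Existence of `φ`. The piece of multidegree at most `r` is spanned by the vectors `x^α ∂^β f_i`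
with exponent `e = (α, β)` bounded by `r`. Order the pairs `(i, e)` by a total order invariant under
translation of `e`; the dimension is the number of pairs whose vector is not in the span of the
smaller ones within the same bound. Adding one slack variable per block turns the pair of `e` and
the bound `r` into a single exponent of multidegree exactly `r`. For fixed `i`, the redundant
exponents then form an upward closed set (`eventuallyBinomial_finrank_filtration`), because
multiplying a monomial by a generator shifts its exponent up to a multiple of a smaller monomial. By
Dickson's lemma such a set has finitely many minimal elements, and inclusion–exclusion counts its
complement by translated products of binomials. Block `j` has `2 n_j` generators and one slack
variable, hence lower index `2 n_j`; this gives the upper degree bounds and the binomial expansion.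

Lower bounds. The commutator with the conjugate generator differentiates a combination of monomials
formally. In characteristic zero, induction on degree shows that a nonzero combination of
multidegree at most `d` does not kill the piece `M_d` (`exists_linearCombination_mon_ne_zero`).
Monomials of multidegree at most `d` are therefore linearly independent in `Hom(M_d, M_{2d})`, so
their number is at most `dim M_d * dim M_{2d}`. Applying this to a set `J` of blocks and restricting
`φ` to rays along `J` gives `deg_{t_i} φ ≥ n_i` for `J = {i}` and `deg φ ≥ n` for all blocks.

Holonomicity. The block filtration and the Bernstein filtration contain each other up to linear
rescaling, and a change of generators costs a bounded shift. Since the total degree of `φ` is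
attained along a ray with positive direction, it equals the degree of the Bernstein polynomial of
every finite system of generators (`totalDegree_eq`). -/

noncomputable section

/-! ### Integer combinations of products of binomial coefficients -/

/-- The function `h` on `ℕ^p` agrees, for large arguments, with an integer combination of the
functions `r ↦ ∏ i, (r i + k i).choose (k i)` with `k ≤ N`. -/
def EventuallyBinomial {p : ℕ} (N : Fin p → ℕ) (h : (Fin p → ℕ) → ℤ) : Prop :=
  ∃ a : (Fin p → ℕ) → ℤ, ∃ s : Fin p → ℕ, ∀ r, s ≤ r →
    h r = ∑ k ∈ Fintype.piFinset (fun i => Finset.range (N i + 1)),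
      a k * ∏ i, ((r i + k i).choose (k i) : ℤ)

namespace EventuallyBinomial

variable {p : ℕ} {N : Fin p → ℕ} {h h₁ h₂ : (Fin p → ℕ) → ℤ}

theorem congr (s : Fin p → ℕ) (H : EventuallyBinomial N h₁) (e : ∀ r, s ≤ r → h₂ r = h₁ r) :
    EventuallyBinomial N h₂ := by
  obtain ⟨a, s₁, h₁⟩ := H
  exact ⟨a, s₁ ⊔ s, fun r hr => by
    rw [e r (le_sup_right.trans hr), h₁ r (le_sup_left.trans hr)]⟩

theorem zero : EventuallyBinomial N (fun _ => 0) :=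
  ⟨0, 0, fun r _ => by simp⟩

theorem add (H₁ : EventuallyBinomial N h₁) (H₂ : EventuallyBinomial N h₂) :
    EventuallyBinomial N (fun r => h₁ r + h₂ r) := by
  obtain ⟨a₁, s₁, h₁⟩ := H₁
  obtain ⟨a₂, s₂, h₂⟩ := H₂
  refine ⟨a₁ + a₂, s₁ ⊔ s₂, fun r hr => ?_⟩
  beta_reduce
  rw [h₁ r (le_sup_left.trans hr), h₂ r (le_sup_right.trans hr), ← Finset.sum_add_distrib]
  exact Finset.sum_congr rfl fun k _ => by simp [add_mul]

theorem neg (H : EventuallyBinomial N h) : EventuallyBinomial N (fun r => -h r) := by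
  obtain ⟨a, s, H⟩ := H
  refine ⟨-a, s, fun r hr => ?_⟩
  beta_reduce
  rw [H r hr, ← Finset.sum_neg_distrib]
  exact Finset.sum_congr rfl fun k _ => by simp

theorem sub (H₁ : EventuallyBinomial N h₁) (H₂ : EventuallyBinomial N h₂) :
    EventuallyBinomial N (fun r => h₁ r - h₂ r) :=
  (H₁.add H₂.neg).congr 0 fun _ _ => sub_eq_add_neg _ _

theorem sum {ι : Type*} (s : Finset ι) {h : ι → (Fin p → ℕ) → ℤ}
    (H : ∀ i ∈ s, EventuallyBinomial N (h i)) :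
    EventuallyBinomial N (fun r => ∑ i ∈ s, h i r) := by
  classical
  induction s using Finset.induction_on with
  | empty => simpa using zero
  | insert i s hi ih =>
    simp only [Finset.sum_insert hi]
    exact (H i (Finset.mem_insert_self i s)).add
      (ih fun j hj => H j (Finset.mem_insert_of_mem hj))

end EventuallyBinomial

/-- A translate of the binomial coefficient `(t + N).choose N` is an integer combination of the
binomial coefficients `(t + k).choose k` with `k ≤ N`. -/
theorem exists_choose_sub_eq_sum (N d : ℕ) : ∃ c : ℕ → ℤ, ∀ t, d ≤ t →
    ((t - d + N).choose N : ℤ) = ∑ k ∈ Finset.range (N + 1), c k * ((t + k).choose k : ℤ) := by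
  induction d generalizing N with
  | zero =>
    refine ⟨Pi.single N 1, fun t _ => ?_⟩
    rw [Finset.sum_eq_single N] <;> simp +contextual
  | succ d ih =>
    cases N with
    | zero => exact ⟨1, fun t _ => by simp⟩
    | succ N =>
      obtain ⟨c₁, h₁⟩ := ih (N + 1)
      obtain ⟨c₂, h₂⟩ := ih N
      -- Pascal's rule: the translate by `d + 1` with lower index `N + 1` is the translate by `d`
      -- with lower index `N + 1` minus the translate by `d` with lower index `N`. The `if` extends
      -- `c₂` by zero.
      refine ⟨fun k => c₁ k - if k < N + 1 then c₂ k else 0, fun t ht => ?_⟩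
      have e : t - d = t - (d + 1) + 1 := by omega
      have hsum : ∑ k ∈ Finset.range (N + 1 + 1),
          (if k < N + 1 then c₂ k else 0) * ((t + k).choose k : ℤ) =
          ∑ k ∈ Finset.range (N + 1), c₂ k * ((t + k).choose k : ℤ) := by
        rw [Finset.sum_range_succ]
        simp only [lt_irrefl, if_false, zero_mul, add_zero]
        exact Finset.sum_congr rfl fun k hk => by rw [if_pos (Finset.mem_range.1 hk)]
      simp only [sub_mul, Finset.sum_sub_distrib]
      rw [hsum, ← h₁ t (by omega), ← h₂ t (by omega), e,
        show t - (d + 1) + 1 + (N + 1) = (t - (d + 1) + (N + 1)) + 1 by ring,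
        Nat.choose_succ_succ,
        show t - (d + 1) + 1 + N = t - (d + 1) + (N + 1) by ring]
      push_cast
      ring

theorem EventuallyBinomial.prod_choose {p : ℕ} (N g : Fin p → ℕ) :
    EventuallyBinomial N (fun r => ∏ i, ((r i - g i + N i).choose (N i) : ℤ)) := by
  choose c hc using fun i => exists_choose_sub_eq_sum (N i) (g i)
  refine ⟨fun k => ∏ i, c i (k i), g, fun r hr => ?_⟩
  beta_reduce
  rw [Finset.prod_congr rfl fun i _ => hc i (r i) (hr i), Finset.prod_univ_sum]
  exact Finset.sum_congr rfl fun k _ => Finset.prod_mul_distrib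

/-! ### Counting exponents of given multidegree -/

/-- The multidegree of `v : V → ℕ` when the coordinates are sorted into blocks by `c`. -/
def blockDeg {V : Type*} [Fintype V] {p : ℕ} (c : V → Fin p) (v : V → ℕ) (j : Fin p) : ℕ :=
  ∑ w with c w = j, v w

section blockDeg

variable {V : Type*} [Fintype V] {p : ℕ} (c : V → Fin p)

theorem blockDeg_add (u v : V → ℕ) : blockDeg c (u + v) = blockDeg c u + blockDeg c v := by
  ext j
  simp [blockDeg, Finset.sum_add_distrib]

theorem blockDeg_single [DecidableEq V] (w : V) :
    blockDeg c (Pi.single w 1) = Pi.single (c w) 1 := by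
  ext j
  simp [blockDeg, Pi.single_apply, eq_comm]

theorem blockDeg_mono {u v : V → ℕ} (h : u ≤ v) : blockDeg c u ≤ blockDeg c v :=
  fun _ => Finset.sum_le_sum fun w _ => h w

theorem le_blockDeg (v : V → ℕ) (w : V) : v w ≤ blockDeg c v (c w) :=
  Finset.single_le_sum (f := v) (fun _ _ => Nat.zero_le _) (by simp)

variable [DecidableEq V]

/-- The finite set of all `v : V → ℕ` of multidegree `r`. -/
def exponentsOfDeg (r : Fin p → ℕ) : Finset (V → ℕ) :=
  (Fintype.piFinset fun w => Finset.range (r (c w) + 1)).filter fun v => blockDeg c v = r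

@[simp] theorem mem_exponentsOfDeg {r : Fin p → ℕ} {v : V → ℕ} :
    v ∈ exponentsOfDeg c r ↔ blockDeg c v = r := by
  simp only [exponentsOfDeg, Finset.mem_filter, Fintype.mem_piFinset, Finset.mem_range,
    and_iff_right_iff_imp]
  rintro rfl w
  exact Nat.lt_succ_of_le (le_blockDeg c v w)

/-- The conditions for different blocks involve disjoint sets of coordinates, so the count is a
product of stars-and-bars counts. -/
theorem card_exponentsOfDeg (r : Fin p → ℕ) :
    (exponentsOfDeg c r).card =
      ∏ j, (Finset.univ.filter fun w => c w = j).card.multichoose (r j) := by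
  have hcard (j : Fin p) : (Finset.univ.filter fun w => c w = j).card.multichoose (r j) =
      (Finset.piAntidiag (Finset.univ.filter fun w => c w = j) (r j)).card := by
    rw [← Finset.card_finsuppAntidiag_nat_eq_multichoose, Finset.finsuppAntidiag,
      Finset.card_map, Finset.card_attach]
  simp only [hcard]
  rw [← Fintype.card_piFinset]
  refine Finset.card_nbij' (fun v j w => if c w = j then v w else 0) (fun f w => f (c w) w)
    ?_ ?_ ?_ ?_
  · intro v hv
    simp only [Finset.mem_coe, mem_exponentsOfDeg] at hv
    subst hv
    simp only [Finset.mem_coe, Fintype.mem_piFinset, Finset.mem_piAntidiag]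
    refine fun j => ⟨Finset.sum_congr rfl fun w hw => ?_, fun w hw => ?_⟩
    · simp [(Finset.mem_filter.1 hw).2]
    · by_contra hj
      simp_all
  · intro f hf
    simp only [Finset.mem_coe, Fintype.mem_piFinset, Finset.mem_piAntidiag] at hf
    simp only [Finset.mem_coe, mem_exponentsOfDeg]
    ext j
    rw [← (hf j).1]
    exact Finset.sum_congr rfl fun w hw => by
      beta_reduce
      rw [(Finset.mem_filter.1 hw).2]
  · intro v _
    simp
  · intro f hf
    simp only [Finset.mem_coe, Fintype.mem_piFinset, Finset.mem_piAntidiag] at hf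
    ext j w
    simp only
    split_ifs with h
    · rw [h]
    · by_contra h0
      exact h (by simpa using (hf j).2 w (Ne.symm h0))

variable {N : Fin p → ℕ} (hN : ∀ j, (Finset.univ.filter fun w => c w = j).card = N j + 1)
include hN

open scoped Classical in
-- Subtracting `g` gives a bijection with all exponents of multidegree `r - blockDeg c g`, where
-- `card_exponentsOfDeg` applies.
theorem EventuallyBinomial.card_exponents_ge (g : V → ℕ) :
    EventuallyBinomial N (fun r => (((exponentsOfDeg c r).filter fun v => g ≤ v).card : ℤ)) := by
  refine (prod_choose N (blockDeg c g)).congr (blockDeg c g) fun r hr => ?_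
  have h1 : ((exponentsOfDeg c r).filter fun v => g ≤ v).card =
      (exponentsOfDeg c (r - blockDeg c g)).card := by
    refine Finset.card_nbij' (fun v => v - g) (fun v => v + g) ?_ ?_ ?_ ?_
    · intro v hv
      simp only [Finset.coe_filter, mem_exponentsOfDeg, Set.mem_ofPred_eq] at hv
      simp only [Finset.mem_coe, mem_exponentsOfDeg]
      rw [← hv.1]
      conv_rhs => rw [← tsub_add_cancel_of_le hv.2, blockDeg_add]
      simp
    · intro v hv
      simp only [Finset.mem_coe, mem_exponentsOfDeg] at hv
      simp only [Finset.coe_filter, mem_exponentsOfDeg, Set.mem_ofPred_eq, blockDeg_add, hv]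
      exact ⟨tsub_add_cancel_of_le hr, le_add_of_nonneg_left zero_le⟩
    · intro v hv
      simp only [Finset.coe_filter, Set.mem_ofPred_eq] at hv
      exact tsub_add_cancel_of_le hv.2
    · intro v _
      simp
  rw [h1, card_exponentsOfDeg, Nat.cast_prod]
  refine Finset.prod_congr rfl fun j _ => ?_
  rw [hN, Nat.multichoose_eq, Nat.choose_symm_of_eq_add (b := N j)]
  · simp only [Pi.sub_apply]
    congr 2
    omega
  · simp only [Pi.sub_apply]
    omega

open scoped Classical in
-- Inclusion–exclusion, removing one `g` from `G`: the exponents above both `g` and some other `g'`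
-- are those above `g ⊔ g'`, which is the same problem with fewer generators.
theorem EventuallyBinomial.card_exponents_exists_ge (G : Finset (V → ℕ)) :
    EventuallyBinomial N
      (fun r => (((exponentsOfDeg c r).filter fun v => ∃ g ∈ G, g ≤ v).card : ℤ)) := by
  induction hG : G.card using Nat.strong_induction_on generalizing G with
  | _ d ih =>
  subst hG
  obtain rfl | ⟨g, hg⟩ := G.eq_empty_or_nonempty
  · simpa using zero
  have hlt := Finset.card_erase_lt_of_mem hg
  have key := ((ih _ hlt _ rfl).add (card_exponents_ge c hN g)).sub
    (ih _ (Finset.card_image_le.trans_lt hlt) ((G.erase g).image (g ⊔ ·)) rfl)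
  refine key.congr 0 fun r _ => ?_
  rw [eq_sub_iff_add_eq]
  norm_cast
  conv_rhs => rw [← Finset.card_union_add_card_inter, ← Finset.filter_or, ← Finset.filter_and]
  congr 2
  · refine Finset.filter_congr fun v _ => ⟨?_, ?_⟩
    · rintro ⟨g', hg', hv⟩
      obtain rfl | hne := eq_or_ne g' g
      · exact .inr hv
      · exact .inl ⟨g', Finset.mem_erase.2 ⟨hne, hg'⟩, hv⟩
    · rintro (⟨g', hg', hv⟩ | hv)
      · exact ⟨g', Finset.mem_of_mem_erase hg', hv⟩
      · exact ⟨g, hg, hv⟩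
  · refine Finset.filter_congr fun v _ => ?_
    simp only [Finset.mem_image, exists_exists_and_eq_and, sup_le_iff]
    constructor
    · rintro ⟨g', h, h1, h2⟩
      exact ⟨⟨g', h, h2⟩, h1⟩
    · rintro ⟨⟨g', h, h2⟩, h1⟩
      exact ⟨g', h, h1, h2⟩

open scoped Classical in
/-- The number of exponents of multidegree `r` outside an upward closed set is given, for large `r`,
by an integer combination of products of binomial coefficients. -/
theorem EventuallyBinomial.card_exponents_notMem {S : Set (V → ℕ)} (hS : IsUpperSet S) :
    EventuallyBinomial N (fun r => (((exponentsOfDeg c r).filter fun v => v ∉ S).card : ℤ)) := by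
  -- Dickson's lemma: the minimal elements of `S` form an antichain in a well-quasi-order, hence a
  -- finite set, and they generate `S` as an upper set.
  have hpwo := Set.isPWO_of_wellQuasiOrderedLE S
  have hfin : {v | Minimal (· ∈ S) v}.Finite :=
    (setOfPred_minimal_antichain _).finite_of_partiallyWellOrderedOn
      (hpwo.mono (setOfPred_minimal_subset _))
  refine ((card_exponents_ge c hN 0).sub (card_exponents_exists_ge c hN hfin.toFinset)).congr 0
    fun r _ => ?_
  have h1 : ((exponentsOfDeg c r).filter fun v => ∃ g ∈ hfin.toFinset, g ≤ v) =
      (exponentsOfDeg c r).filter fun v => v ∈ S := by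
    refine Finset.filter_congr fun v _ => ⟨?_, fun hv => ?_⟩
    · rintro ⟨g, hg, hle⟩
      exact hS hle ((hfin.mem_toFinset.1 hg).prop)
    · obtain ⟨g, hle, hg⟩ := hpwo.exists_le_minimal hv
      exact ⟨g, hfin.mem_toFinset.2 hg, hle⟩
  have h2 : ((exponentsOfDeg c r).filter fun v => 0 ≤ v) = exponentsOfDeg c r :=
    Finset.filter_true_of_mem fun _ _ => zero_le
  rw [h1, h2, ← Finset.card_filter_add_card_filter_not (s := exponentsOfDeg c r) (fun v => v ∈ S)]
  push_cast
  ring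

end blockDeg

/-! ### Standard elements of a finite ordered family of vectors -/

open scoped Classical in
/-- The dimension of the span of a finite family is the number of its members that do not lie in
the span of the smaller ones. -/
theorem finrank_span_image_eq_card_filter {K M E L : Type*} [Field K] [AddCommGroup M] [Module K M]
    [LinearOrder L] {key : E → L} (hkey : Function.Injective key) (v : E → M) (F : Finset E) :
    Module.finrank K (Submodule.span K (v '' F)) =
      (F.filter fun u => v u ∉ Submodule.span K (v '' {u' | u' ∈ F ∧ key u' < key u})).card := by
  suffices H : ∀ F : Finset E, ∃ B : Finset E,
      B = (F.filter fun u => v u ∉ Submodule.span K (v '' {u' | u' ∈ F ∧ key u' < key u})) ∧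
      LinearIndepOn K v (B : Set E) ∧
        Submodule.span K (v '' (B : Set E)) = Submodule.span K (v '' F) by
    obtain ⟨B, hB, hli, hspan⟩ := H F
    rw [← hspan, ← hB, Set.image_eq_range]
    exact (finrank_span_eq_card hli).trans (by simp)
  intro F
  -- Inserting the members in increasing order of `key` leaves the status of the earlier ones
  -- unchanged.
  induction F using Finset.induction_on_max_value key with
  | empty => exact ⟨∅, by simp, by simp, by simp⟩
  | insert a F ha hmax ih =>
    obtain ⟨B, hB, hli, hspan⟩ := ih
    have hlt (x : E) (hx : x ∈ F) : key x < key a :=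
      (hmax x hx).lt_of_ne fun h => ha (hkey h ▸ hx)
    have hset_a : {u' | u' ∈ insert a F ∧ key u' < key a} = (F : Set E) := by
      ext x
      simp only [Finset.mem_insert, Set.mem_ofPred_eq, Finset.mem_coe]
      constructor
      · rintro ⟨rfl | h, h'⟩
        · exact absurd h' (lt_irrefl _)
        · exact h
      · exact fun h => ⟨.inr h, hlt x h⟩
    have hset (u : E) (hu : u ∈ F) : {u' | u' ∈ insert a F ∧ key u' < key u} =
        {u' | u' ∈ F ∧ key u' < key u} := by
      ext x
      simp only [Finset.mem_insert, Set.mem_ofPred_eq]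
      constructor
      · rintro ⟨rfl | h, h'⟩
        · exact absurd (h'.trans (hlt u hu)) (lt_irrefl _)
        · exact ⟨h, h'⟩
      · exact fun h => ⟨.inr h.1, h.2⟩
    have hfil : (F.filter fun u => v u ∉
        Submodule.span K (v '' {u' | u' ∈ insert a F ∧ key u' < key u})) = B := by
      rw [hB]
      exact Finset.filter_congr fun u hu => by rw [hset u hu]
    rw [Finset.filter_insert, hset_a, hfil]
    by_cases hva : v a ∈ Submodule.span K (v '' (F : Set E))
    · refine ⟨B, by simp [hva], hli, ?_⟩
      rw [hspan, Finset.coe_insert, Set.image_insert_eq, Submodule.span_insert_eq_span hva]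
    · refine ⟨insert a B, by simp [hva], ?_, ?_⟩
      · rw [Finset.coe_insert]
        exact hli.insert (by rwa [hspan])
      · rw [Finset.coe_insert, Finset.coe_insert, Set.image_insert_eq, Set.image_insert_eq,
          Submodule.span_insert, Submodule.span_insert, hspan]

/-- There is a total order on `Fin m × ℕ^(n + n)` that is invariant under translations of the second
component and extends the componentwise order on it. -/
theorem exists_exponent_order (m n : ℕ) :
    ∃ (L : Type) (_ : LinearOrder L) (key : Fin m × (Fin n ⊕ Fin n → ℕ) → L),
      Function.Injective key ∧
      (∀ i i' e e' d, key (i, e) < key (i', e') → key (i, e + d) < key (i', e' + d)) ∧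
      ∀ i e e', e < e' → key (i, e) < key (i, e') := by
  -- Exponents are compared lexicographically and the index of the generator only breaks ties.
  -- Compatibility with the multidegree is not needed, since the degree bound is tracked separately
  -- by the slack variables.
  refine ⟨Lex (Lex (Lex (Fin n → ℕ) × Lex (Fin n → ℕ)) × Fin m), inferInstance,
    fun u => toLex (toLex (toLex (u.2 ∘ Sum.inl), toLex (u.2 ∘ Sum.inr)), u.1), ?_, ?_, ?_⟩
  · rintro ⟨i, e⟩ ⟨i', e'⟩ h
    simp only [EmbeddingLike.apply_eq_iff_eq, Prod.mk.injEq] at h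
    obtain ⟨⟨h1, h2⟩, h3⟩ := h
    refine Prod.ext h3 (funext fun w => ?_)
    cases w with
    | inl k => exact congrFun h1 k
    | inr k => exact congrFun h2 k
  · intro i i' e e' d h
    have hcancel (j : Fin n → Fin n ⊕ Fin n) (e e' : Fin n ⊕ Fin n → ℕ) :
        (e + d) ∘ j = (e' + d) ∘ j ↔ e ∘ j = e' ∘ j :=
      add_left_inj (d ∘ j) (b := e ∘ j) (c := e' ∘ j)
    have hl (e : Fin n ⊕ Fin n → ℕ) :
        toLex ((e + d) ∘ Sum.inl) = toLex (e ∘ Sum.inl) + toLex (d ∘ Sum.inl) := rfl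
    have hr (e : Fin n ⊕ Fin n → ℕ) :
        toLex ((e + d) ∘ Sum.inr) = toLex (e ∘ Sum.inr) + toLex (d ∘ Sum.inr) := rfl
    simp only [Prod.Lex.toLex_lt_toLex, EmbeddingLike.apply_eq_iff_eq, Prod.mk.injEq] at h ⊢
    simpa only [hl, hr, add_lt_add_iff_right, hcancel] using h
  · intro i e e' h
    simp only [Prod.Lex.toLex_lt_toLex, EmbeddingLike.apply_eq_iff_eq]
    left
    have h1 : e ∘ Sum.inl ≤ e' ∘ Sum.inl := fun k => h.le (Sum.inl k)
    have h2 : e ∘ Sum.inr ≤ e' ∘ Sum.inr := fun k => h.le (Sum.inr k)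
    obtain h1 | h1 := h1.lt_or_eq
    · exact .inl (Pi.toLex_strictMono h1)
    · refine .inr ⟨h1, Pi.toLex_strictMono (h2.lt_of_ne fun h2 => h.ne (funext fun w => ?_))⟩
      cases w with
      | inl k => exact congrFun h1 k
      | inr k => exact congrFun h2 k

/-! ### Ordered products of powers -/

theorem List.prod_ofFn_pow_add_single {R : Type*} [Monoid R] {n : ℕ} (a : Fin n → R)
    (ha : ∀ k l, Commute (a k) (a l)) (α : Fin n → ℕ) (j : Fin n) :
    (List.ofFn fun k => a k ^ (α + Pi.single j 1 : Fin _ → ℕ) k).prod =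
      a j * (List.ofFn fun k => a k ^ α k).prod := by
  induction n with
  | zero => exact j.elim0
  | succ n ih =>
    simp only [List.ofFn_succ, List.prod_cons]
    cases j using Fin.cases with
    | zero => simp [pow_succ', mul_assoc]
    | succ j =>
      have := ih (fun k => a k.succ) (fun k l => ha _ _) (fun k => α k.succ) j
      have e : (fun k : Fin n => a k.succ ^ (α + Pi.single j.succ 1 : Fin _ → ℕ) k.succ) =
          fun k : Fin n => a k.succ ^ ((fun k => α k.succ) + Pi.single j 1 : Fin n → ℕ) k := by
        ext k
        simp [Pi.single_apply]
      rw [e, this, ← mul_assoc, ← mul_assoc]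
      congr 1
      simpa using ((ha j.succ 0).pow_right (α 0)).eq.symm

/-- Leibniz rule for the commutator with `y`. At `t = 0` the truncated exponent `t - 1` is harmless
because the coefficient vanishes. -/
theorem mul_pow_sub_pow_mul {R : Type*} [Ring R] {y a : R} {ε : ℤ} (h : y * a - a * y = ε)
    (t : ℕ) : y * a ^ t - a ^ t * y = (ε * t) • a ^ (t - 1) := by
  induction t with
  | zero => simp
  | succ t ih =>
    have e1 : y * a ^ (t + 1) - a ^ (t + 1) * y =
        (y * a ^ t - a ^ t * y) * a + a ^ t * (y * a - a * y) := by
      rw [pow_succ]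
      noncomm_ring
    rw [e1, ih, h, smul_mul_assoc]
    cases t with
    | zero => simp
    | succ t =>
      have : (a ^ (t + 1)) * (ε : R) = ε • a ^ (t + 1) := by
        rw [zsmul_eq_mul, (Int.cast_commute ε (a ^ (t + 1))).eq]
      rw [this]
      simp only [Nat.add_sub_cancel, ← pow_succ, ← add_smul]
      congr 1
      push_cast
      ring

/-- The commutator of an ordered product of powers with an element whose commutators with the factors
are `0` except for one, which is an integer. -/
theorem mul_prod_ofFn_pow_sub {R : Type*} [Ring R] {n : ℕ} (a : Fin n → R) (y : R) (ε : ℤ)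
    (j : Fin n) (h : ∀ k, y * a k - a k * y = if k = j then (ε : R) else 0) (α : Fin n → ℕ) :
    y * (List.ofFn fun k => a k ^ α k).prod - (List.ofFn fun k => a k ^ α k).prod * y =
      (ε * α j) • (List.ofFn fun k => a k ^ (α - Pi.single j 1 : Fin _ → ℕ) k).prod := by
  have hcomm {n : ℕ} (a : Fin n → R) (h : ∀ k, y * a k - a k * y = 0) (α : Fin n → ℕ) :
      y * (List.ofFn fun k => a k ^ α k).prod = (List.ofFn fun k => a k ^ α k).prod * y := by
    refine (Commute.list_prod_right _ _ fun z hz => ?_).eq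
    obtain ⟨k, rfl⟩ := List.mem_ofFn.1 hz
    exact Commute.pow_right (sub_eq_zero.1 (h k)) _
  induction n with
  | zero => exact j.elim0
  | succ n ih =>
    simp only [List.ofFn_succ, List.prod_cons]
    cases j using Fin.cases with
    | zero =>
      have e : (fun k : Fin n => a k.succ ^ (α - Pi.single (0 : Fin (n + 1)) 1 : Fin _ → ℕ) k.succ) =
          fun k => a k.succ ^ α k.succ := by
        ext k
        simp
      rw [e]
      have h1 := mul_pow_sub_pow_mul (by simpa using h 0) (α 0)
      have h2 := hcomm (fun k => a k.succ) (fun k => by simpa using h k.succ) (fun k => α k.succ)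
      rw [mul_assoc, ← h2, ← mul_assoc, ← mul_assoc, ← sub_mul, h1]
      simp [mul_assoc]
    | succ j =>
      have e : (fun k : Fin n => a k.succ ^ (α - Pi.single j.succ 1 : Fin _ → ℕ) k.succ) =
          fun k : Fin n => a k.succ ^ ((fun k => α k.succ) - Pi.single j 1 : Fin n → ℕ) k := by
        ext k
        simp [Pi.single_apply]
      rw [e]
      have h1 := ih (fun k => a k.succ) j (fun k => by simpa using h k.succ) (fun k => α k.succ)
      have h2 : y * a 0 ^ α 0 = a 0 ^ α 0 * y :=
        (Commute.pow_right (sub_eq_zero.1 (by rw [h, if_neg (Fin.succ_ne_zero j).symm])) _ :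
          Commute y (a 0 ^ α 0)).eq
      rw [← mul_assoc, h2, mul_assoc, mul_assoc, ← mul_sub, h1, mul_smul_comm]
      simp

/-! ### The Weyl relations -/

/-- The defining relations of the Weyl algebra. -/
structure WeylRelations {R : Type*} [Ring R] {n : ℕ} (x d : Fin n → R) : Prop where
  x_commute : ∀ k l, Commute (x k) (x l)
  d_commute : ∀ k l, Commute (d k) (d l)
  d_mul_x_sub : ∀ k l, d k * x l - x l * d k = if k = l then 1 else 0

namespace WeylRelations

variable {R : Type*} [Ring R] {n : ℕ} (x d : Fin n → R)

/-- The generators `x_k` and `d_k` as one family. -/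
abbrev gen : Fin n ⊕ Fin n → R := Sum.elim x d

/-- The generator conjugate to `gen x d w`: `d_k` for `x_k`, and `x_k` for `d_k`. -/
abbrev dualGen : Fin n ⊕ Fin n → R := Sum.elim d x

/-- The sign in the commutator of `dualGen x d w` and `gen x d w`. -/
def genSign : Fin n ⊕ Fin n → ℤ := Sum.elim (fun _ => 1) (fun _ => -1)

/-- The monomial with exponents `e`. -/
def mon (e : Fin n ⊕ Fin n → ℕ) : R :=
  (List.ofFn fun k => x k ^ (e ∘ Sum.inl) k).prod * (List.ofFn fun k => d k ^ (e ∘ Sum.inr) k).prod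

@[simp] theorem mon_zero : mon x d 0 = 1 := by
  simp [mon]

variable {x d} (h : WeylRelations x d)
include h

theorem x_mul_mon (k : Fin n) (e : Fin n ⊕ Fin n → ℕ) :
    x k * mon x d e = mon x d (e + Pi.single (Sum.inl k) 1) := by
  have h1 : (e + Pi.single (Sum.inl k) 1) ∘ Sum.inl = e ∘ Sum.inl + Pi.single k 1 := by
    ext l; simp [Pi.single_apply]
  have h2 : (e + Pi.single (Sum.inl k) 1) ∘ Sum.inr = e ∘ Sum.inr := by
    ext l; simp
  rw [mon, mon, h1, h2, List.prod_ofFn_pow_add_single _ h.x_commute, mul_assoc]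

theorem d_commute_prod (k : Fin n) (β : Fin n → ℕ) :
    Commute (d k) (List.ofFn fun l => d l ^ β l).prod := by
  refine Commute.list_prod_right _ _ fun z hz => ?_
  obtain ⟨l, rfl⟩ := List.mem_ofFn.1 hz
  exact (h.d_commute k l).pow_right _

theorem x_commute_prod (k : Fin n) (α : Fin n → ℕ) :
    Commute (x k) (List.ofFn fun l => x l ^ α l).prod := by
  refine Commute.list_prod_right _ _ fun z hz => ?_
  obtain ⟨l, rfl⟩ := List.mem_ofFn.1 hz
  exact (h.x_commute k l).pow_right _

theorem mon_mul_d (k : Fin n) (e : Fin n ⊕ Fin n → ℕ) :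
    mon x d e * d k = mon x d (e + Pi.single (Sum.inr k) 1) := by
  have h1 : (e + Pi.single (Sum.inr k) 1) ∘ Sum.inr = e ∘ Sum.inr + Pi.single k 1 := by
    ext l; simp [Pi.single_apply]
  have h2 : (e + Pi.single (Sum.inr k) 1) ∘ Sum.inl = e ∘ Sum.inl := by
    ext l; simp
  rw [mon, mon, h1, h2, List.prod_ofFn_pow_add_single _ h.d_commute, mul_assoc,
    (h.d_commute_prod k _).eq]

/-- Commutators with the generators lower the exponents of monomials. -/
theorem dualGen_mul_mon_sub (w : Fin n ⊕ Fin n) (e : Fin n ⊕ Fin n → ℕ) :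
    dualGen x d w * mon x d e - mon x d e * dualGen x d w =
      (genSign w * e w) • mon x d (e - Pi.single w 1) := by
  cases w with
  | inl k =>
    have h1 : (e - Pi.single (Sum.inl k) 1) ∘ Sum.inl = e ∘ Sum.inl - Pi.single k 1 := by
      ext l; simp [Pi.single_apply]
    have h2 : (e - Pi.single (Sum.inl k) 1) ∘ Sum.inr = e ∘ Sum.inr := by
      ext l; simp
    have h4 := mul_prod_ofFn_pow_sub x (d k) 1 k
      (fun l => by rw [h.d_mul_x_sub]; simp [eq_comm]) (e ∘ Sum.inl)
    simp only [dualGen, genSign, Sum.elim_inl]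
    rw [mon, mon, h1, h2, mul_assoc, ← (h.d_commute_prod k _).eq, ← mul_assoc, ← mul_assoc,
      ← sub_mul, h4, smul_mul_assoc]
    rfl
  | inr k =>
    have h1 : (e - Pi.single (Sum.inr k) 1) ∘ Sum.inr = e ∘ Sum.inr - Pi.single k 1 := by
      ext l; simp [Pi.single_apply]
    have h2 : (e - Pi.single (Sum.inr k) 1) ∘ Sum.inl = e ∘ Sum.inl := by
      ext l; simp
    have h4 := mul_prod_ofFn_pow_sub d (x k) (-1) k
      (fun l => by rw [← neg_sub, h.d_mul_x_sub]; split_ifs <;> simp) (e ∘ Sum.inr)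
    simp only [dualGen, genSign, Sum.elim_inr]
    rw [mon, mon, h1, h2, ← mul_assoc, (h.x_commute_prod k _).eq, mul_assoc, mul_assoc,
      ← mul_sub, h4, mul_smul_comm]
    rfl

/-- Multiplication by a generator shifts the exponents, up to a multiple of a smaller monomial. -/
theorem exists_gen_mul_mon (w : Fin n ⊕ Fin n) (e : Fin n ⊕ Fin n → ℕ) :
    ∃ (c : ℤ) (e' : Fin n ⊕ Fin n → ℕ), e' ≤ e ∧
      gen x d w * mon x d e = mon x d (e + Pi.single w 1) + c • mon x d e' := by
  cases w with
  | inl k => exact ⟨0, 0, zero_le, by simp [gen, h.x_mul_mon]⟩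
  | inr k =>
    -- Moving `d k` to the right through the monomial produces one commutator, which is the
    -- correction term.
    refine ⟨genSign (Sum.inl k) * e (Sum.inl k), e - Pi.single (Sum.inl k) 1, tsub_le_self, ?_⟩
    rw [← h.mon_mul_d, ← h.dualGen_mul_mon_sub (Sum.inl k) e]
    simp [gen, dualGen]

end WeylRelations

/-! ### The filtration of a module over the Weyl algebra -/

section exponentsLE

variable {V : Type*} [Fintype V] {p : ℕ} (c : V → Fin p)

/-- Homogenizing variables, one for each block, turn inequalities of degrees into equalities. -/
theorem blockDeg_sumElim_id (u : Fin p ⊕ V → ℕ) :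
    blockDeg (Sum.elim id c) u = u ∘ Sum.inl + blockDeg c (u ∘ Sum.inr) := by
  ext j
  simp only [blockDeg, Finset.sum_filter, Fintype.sum_sum_type, Pi.add_apply]
  refine congrArg₂ (· + ·) ((Finset.sum_eq_single j ?_ ?_).trans ?_) rfl <;> simp +contextual

theorem card_sumElim_id_fiber (j : Fin p) :
    (Finset.univ.filter fun w => (Sum.elim id c : Fin p ⊕ V → Fin p) w = j).card =
      (Finset.univ.filter fun w => c w = j).card + 1 := by
  rw [Finset.card_filter, Fintype.sum_sum_type, add_comm, Finset.card_filter]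
  refine congrArg₂ (· + ·) rfl ((Finset.sum_eq_single j ?_ ?_).trans ?_) <;> simp +contextual

variable [DecidableEq V]

open scoped Classical in
/-- The finite set of all `v : V → ℕ` of multidegree at most `r`. -/
def exponentsLE (r : Fin p → ℕ) : Finset (V → ℕ) :=
  (Fintype.piFinset fun w => Finset.range (r (c w) + 1)).filter fun v => blockDeg c v ≤ r

@[simp] theorem mem_exponentsLE {r : Fin p → ℕ} {v : V → ℕ} :
    v ∈ exponentsLE c r ↔ blockDeg c v ≤ r := by
  simp only [exponentsLE, Finset.mem_filter, Fintype.mem_piFinset, Finset.mem_range,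
    and_iff_right_iff_imp]
  exact fun h w => Nat.lt_succ_of_le ((le_blockDeg c v w).trans (h _))

/-- The translations preserving `S` form an additive submonoid, and the unit vectors generate `V →
ℕ`. -/
theorem isUpperSet_of_add_single {S : Set (V → ℕ)}
    (hS : ∀ u ∈ S, ∀ w, u + Pi.single w 1 ∈ S) : IsUpperSet S := by
  let T : AddSubmonoid (V → ℕ) :=
    { carrier := {d | ∀ u ∈ S, u + d ∈ S}
      zero_mem' := fun u hu => by simpa using hu
      add_mem' := fun {a b} ha hb u hu => by
        rw [← add_assoc]
        exact hb _ (ha _ hu) }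
  have hT (d : V → ℕ) : d ∈ T := by
    have : d = ∑ w, d w • Pi.single w 1 := by
      ext w
      simp [Finset.sum_apply, Pi.single_apply]
    rw [this]
    exact sum_mem fun w _ => nsmul_mem (show Pi.single w 1 ∈ T from fun u hu => hS u hu w) _
  intro u u' hle hu
  rw [← add_tsub_cancel_of_le hle]
  exact hT _ u hu

end exponentsLE

namespace WeylRelations

variable {K M : Type*} [Field K] [AddCommGroup M] [Module K M] {n p m : ℕ}

section

variable (X D : Fin n → Module.End K M) (c : Fin n ⊕ Fin n → Fin p) (f : Fin m → M)

/-- The span of the vectors obtained by applying the monomials of multidegree at most `r` to the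
generators `f`. -/
def filtration (r : Fin p → ℕ) : Submodule K M :=
  Submodule.span K ((fun q : Fin m × (Fin n ⊕ Fin n → ℕ) => mon X D q.2 (f q.1)) ''
    ((Finset.univ ×ˢ exponentsLE c r : Finset (Fin m × (Fin n ⊕ Fin n → ℕ))) : Set _))

instance finite_filtration (r : Fin p → ℕ) : Module.Finite K (filtration X D c f r) :=
  Module.Finite.span_of_finite K ((Finset.finite_toSet _).image _)

variable {X D c f}

theorem mon_mem_filtration {r : Fin p → ℕ} {e : Fin n ⊕ Fin n → ℕ} (he : blockDeg c e ≤ r)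
    (i : Fin m) : mon X D e (f i) ∈ filtration X D c f r :=
  Submodule.subset_span ⟨(i, e), by simpa using he, rfl⟩

theorem generator_mem_filtration (r : Fin p → ℕ) (i : Fin m) : f i ∈ filtration X D c f r := by
  have h : blockDeg c (0 : Fin n ⊕ Fin n → ℕ) ≤ r := by
    intro j
    simp [blockDeg]
  simpa using mon_mem_filtration (X := X) (D := D) (f := f) h i

theorem filtration_le {r : Fin p → ℕ} {P : Submodule K M}
    (h : ∀ i e, blockDeg c e ≤ r → mon X D e (f i) ∈ P) : filtration X D c f r ≤ P := by
  refine Submodule.span_le.2 ?_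
  rintro _ ⟨⟨i, e⟩, he, rfl⟩
  exact h i e (by simpa using he)

theorem filtration_mono {r r' : Fin p → ℕ} (h : r ≤ r') :
    filtration X D c f r ≤ filtration X D c f r' :=
  filtration_le fun i _ he => mon_mem_filtration (he.trans h) i

end

variable {X D : Fin n → Module.End K M} (h : WeylRelations X D)
include h

theorem gen_mem_filtration {c : Fin n ⊕ Fin n → Fin p} {f : Fin m → M} {r : Fin p → ℕ} {y : M}
    (hy : y ∈ filtration X D c f r) (w : Fin n ⊕ Fin n) :
    gen X D w y ∈ filtration X D c f (r + Pi.single (c w) 1) := by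
  suffices H : filtration X D c f r ≤
      (filtration X D c f (r + Pi.single (c w) 1)).comap (gen X D w) from H hy
  refine filtration_le fun i e he => ?_
  obtain ⟨a, e', he', h'⟩ := h.exists_gen_mul_mon w e
  rw [Submodule.mem_comap, ← Module.End.mul_apply, h']
  refine add_mem (mon_mem_filtration ?_ i) ?_
  · rw [blockDeg_add, blockDeg_single]
    exact add_le_add_left he _
  · rw [LinearMap.smul_apply]
    exact zsmul_mem (mon_mem_filtration
      (((blockDeg_mono c he').trans he).trans le_self_add) i) a

/-- The dimensions of the filtration are given, for large arguments, by an integer combination of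
products of binomial coefficients. -/
theorem eventuallyBinomial_finrank_filtration (c : Fin n ⊕ Fin n → Fin p) (f : Fin m → M) :
    EventuallyBinomial (fun j => (Finset.univ.filter fun w => c w = j).card)
      (fun r => (Module.finrank K (filtration X D c f r) : ℤ)) := by
  classical
  obtain ⟨L, _, key, hinj, hadd, hlt⟩ := exists_exponent_order m n
  set v : Fin m × (Fin n ⊕ Fin n → ℕ) → M := fun q => mon X D q.2 (f q.1) with hv
  let lower (r : Fin p → ℕ) (q : Fin m × (Fin n ⊕ Fin n → ℕ)) :
    Set (Fin m × (Fin n ⊕ Fin n → ℕ)) := {q' | blockDeg c q'.2 ≤ r ∧ key q' < key q}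
  -- The redundant homogenized exponents. The slack coordinates of `u` record how far the bound
  -- exceeds the degree of the monomial, so one set `S i` encodes redundancy for all bounds at once.
  let S (i : Fin m) : Set (Fin p ⊕ (Fin n ⊕ Fin n) → ℕ) :=
    {u | v (i, u ∘ Sum.inr) ∈
      Submodule.span K (v '' lower (blockDeg (Sum.elim id c) u) (i, u ∘ Sum.inr))}
  have hS (i : Fin m) : IsUpperSet (S i) := by
    refine isUpperSet_of_add_single fun u hu w => ?_
    have hdeg : blockDeg c (u ∘ Sum.inr) ≤ blockDeg (Sum.elim id c) u := by
      rw [blockDeg_sumElim_id]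
      exact le_add_self
    simp only [S, Set.mem_ofPred_eq, blockDeg_add, blockDeg_single] at hu ⊢
    cases w with
    | inl j =>
      have e : (u + Pi.single (Sum.inl j) 1) ∘ Sum.inr = u ∘ Sum.inr := by ext w; simp
      rw [e]
      refine Submodule.span_mono (Set.image_mono ?_) hu
      exact fun q hq => ⟨hq.1.trans le_self_add, hq.2⟩
    | inr w =>
      have e : (u + Pi.single (Sum.inr w) 1) ∘ Sum.inr = u ∘ Sum.inr + Pi.single w 1 := by
        ext w'
        simp [Pi.single_apply]
      rw [e]
      simp only [Sum.elim_inr]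
      generalize u ∘ Sum.inr = e at hu hdeg
      generalize blockDeg (Sum.elim id c) u = r at hu hdeg
      set P := Submodule.span K (v '' lower (r + Pi.single (c w) 1) (i, e + Pi.single w 1))
      -- The correction monomials lie below `e'`, so they have smaller key than `e' + Pi.single w 1`
      -- and respect the degree bound.
      have hlow (i' : Fin m) (e' e'' : Fin n ⊕ Fin n → ℕ) (hle : e'' ≤ e')
          (hd : blockDeg c e' ≤ r)
          (hk : key (i', e' + Pi.single w 1) ≤ key (i, e + Pi.single w 1)) :
          v (i', e'') ∈ P := by
        refine Submodule.subset_span ⟨_, ⟨?_, ?_⟩, rfl⟩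
        · exact ((blockDeg_mono c hle).trans hd).trans le_self_add
        · refine lt_of_lt_of_le (hlt _ _ _ (hle.trans_lt ?_)) hk
          exact lt_add_of_pos_right _ (Pi.single_pos.2 one_pos)
      -- Multiplication by a generator sends vectors below `(i, e)` to combinations of vectors below
      -- the shifted pair, by translation invariance of the order.
      have hP : Submodule.span K (v '' lower r (i, e)) ≤ P.comap (gen X D w) := by
        refine Submodule.span_le.2 ?_
        rintro _ ⟨⟨i', e'⟩, ⟨hd, hk⟩, rfl⟩
        obtain ⟨a, e'', he'', h'⟩ := h.exists_gen_mul_mon w e'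
        have hk' := hadd _ _ _ _ (Pi.single w 1) hk
        have heq : gen X D w (v (i', e')) = v (i', e' + Pi.single w 1) + a • v (i', e'') := by
          rw [hv, ← Module.End.mul_apply, h', LinearMap.add_apply, LinearMap.smul_apply]
        rw [SetLike.mem_coe, Submodule.mem_comap, heq]
        refine add_mem (Submodule.subset_span ⟨_, ⟨?_, hk'⟩, rfl⟩)
          (zsmul_mem (hlow i' e' e'' he'' hd hk'.le) a)
        simp only [blockDeg_add, blockDeg_single]
        exact add_le_add_left hd _
      obtain ⟨a, e', he', h'⟩ := h.exists_gen_mul_mon w e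
      have heq : v (i, e + Pi.single w 1) = gen X D w (v (i, e)) - a • v (i, e') := by
        rw [hv, ← Module.End.mul_apply, h', LinearMap.add_apply, LinearMap.smul_apply,
          add_sub_cancel_right]
      rw [heq]
      exact sub_mem (hP hu) (zsmul_mem (hlow i e e' he' hdeg le_rfl) a)
  refine (EventuallyBinomial.sum Finset.univ fun i _ =>
    EventuallyBinomial.card_exponents_notMem (Sum.elim id c) (card_sumElim_id_fiber c)
      (hS i)).congr 0 fun r _ => ?_
  rw [filtration, finrank_span_image_eq_card_filter hinj, ← Nat.cast_sum, Nat.cast_inj,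
    ← Finset.card_sigma]
  have hlower (q : Fin m × (Fin n ⊕ Fin n → ℕ)) :
      {q' | q' ∈ (Finset.univ ×ˢ exponentsLE c r : Finset (Fin m × (Fin n ⊕ Fin n → ℕ))) ∧
        key q' < key q} = lower r q := by
    ext q'
    simp [lower]
  simp only [hlower]
  -- Homogenization `e ↦ (r - blockDeg c e, e)` and its inverse, forgetting the slack coordinates.
  refine Finset.card_nbij'
    (fun q => ⟨q.1, Sum.elim (r - blockDeg c q.2) q.2⟩) (fun q => (q.1, q.2 ∘ Sum.inr)) ?_ ?_ ?_ ?_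
  · rintro ⟨i, e⟩ hq
    simp only [Finset.coe_filter, Finset.mem_product, Finset.mem_univ, mem_exponentsLE, true_and,
      Set.mem_ofPred_eq] at hq
    have hd : blockDeg (Sum.elim id c) (Sum.elim (r - blockDeg c e) e) = r := by
      rw [blockDeg_sumElim_id]
      simpa using tsub_add_cancel_of_le hq.1
    simp only [Finset.coe_sigma, Set.mem_sigma_iff, Finset.coe_univ, Set.mem_univ, true_and,
      Finset.coe_filter, mem_exponentsOfDeg, Set.mem_ofPred_eq, S, hd, Sum.elim_comp_inr]
    exact hq.2
  · rintro ⟨i, u⟩ hq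
    simp only [Finset.coe_sigma, Set.mem_sigma_iff, Finset.coe_univ, Set.mem_univ, true_and,
      Finset.coe_filter, mem_exponentsOfDeg, Set.mem_ofPred_eq, S] at hq
    simp only [Finset.coe_filter, Finset.mem_product, Finset.mem_univ, mem_exponentsLE, true_and,
      Set.mem_ofPred_eq]
    obtain ⟨hd, hq⟩ := hq
    rw [hd] at hq
    refine ⟨?_, hq⟩
    rw [← hd, blockDeg_sumElim_id]
    exact le_add_self
  · rintro ⟨i, e⟩ _
    simp
  · rintro ⟨i, u⟩ hq
    simp only [Finset.coe_sigma, Set.mem_sigma_iff, Finset.coe_univ, Set.mem_univ, true_and,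
      Finset.coe_filter, mem_exponentsOfDeg, Set.mem_ofPred_eq] at hq
    simp only [Sigma.mk.injEq, heq_eq_eq, true_and]
    rw [← hq.1, blockDeg_sumElim_id, add_tsub_cancel_right, Sum.elim_comp_inl_inr]

end WeylRelations

theorem card_filter_sumElim_self {n p : ℕ} (b : Fin n → Fin p) (P : Fin p → Prop)
    [DecidablePred P] :
    (Finset.univ.filter fun w => P ((Sum.elim b b : Fin n ⊕ Fin n → Fin p) w)).card =
      2 * (Finset.univ.filter fun k => P (b k)).card := by
  rw [Finset.card_filter, Finset.card_filter, Fintype.sum_sum_type, two_mul]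
  rfl

namespace WeylRelations

theorem genSign_smul_eq_zero {M : Type*} [AddCommGroup M] {n : ℕ} {y : M}
    {w : Fin n ⊕ Fin n} (hy : genSign w • y = 0) :
    y = 0 := by
  cases w <;> simpa [genSign] using hy

variable {K M : Type*} [Field K] [AddCommGroup M] [Module K M] {n p m : ℕ}

/-! ### The Bernstein inequality -/

section formal

variable (K n) in
/-- The formal derivative, with respect to the variable `w`, of a combination of exponents. -/
def formalDeriv (w : Fin n ⊕ Fin n) :
    ((Fin n ⊕ Fin n → ℕ) →₀ K) →ₗ[K] ((Fin n ⊕ Fin n → ℕ) →₀ K) :=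
  Finsupp.linearCombination K fun e => Finsupp.single (e - Pi.single w 1) (e w : K)

theorem formalDeriv_apply (w : Fin n ⊕ Fin n) (g : (Fin n ⊕ Fin n → ℕ) →₀ K)
    (e : Fin n ⊕ Fin n → ℕ) :
    formalDeriv K n w g e = (e w + 1) * g (e + Pi.single w 1) := by
  induction g using Finsupp.induction_linear with
  | zero => simp
  | add g₁ g₂ h₁ h₂ => simp [h₁, h₂, mul_add]
  | single e' a =>
    simp only [formalDeriv, Finsupp.linearCombination_single, Finsupp.smul_single, smul_eq_mul,
      Finsupp.single_apply]
    obtain h0 | h0 := Nat.eq_zero_or_pos (e' w)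
    · have hne : e' ≠ e + Pi.single w 1 := by
        rintro rfl
        simp at h0
      simp [h0, hne]
    · have hle : Pi.single w 1 ≤ e' := by
        intro w'
        obtain rfl | hw := eq_or_ne w' w
        · simpa using Nat.succ_le_of_lt h0
        · simp [hw]
      have hiff : e' - Pi.single w 1 = e ↔ e' = e + Pi.single w 1 :=
        tsub_eq_iff_eq_add_of_le hle
      by_cases h : e' = e + Pi.single w 1
      · rw [if_pos (hiff.2 h), if_pos h, h]
        simp [mul_comm]
      · rw [if_neg (mt hiff.1 h), if_neg h, mul_zero]

variable {X D : Fin n → Module.End K M} (h : WeylRelations X D)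
include h

/-- This commutator lowers the degree of `g`, which drives the induction behind the Bernstein
inequality. -/
theorem dualGen_mul_linearCombination_sub (w : Fin n ⊕ Fin n)
    (g : (Fin n ⊕ Fin n → ℕ) →₀ K) :
    dualGen X D w * Finsupp.linearCombination K (mon X D) g -
      Finsupp.linearCombination K (mon X D) g * dualGen X D w =
      genSign w • Finsupp.linearCombination K (mon X D) (formalDeriv K n w g) := by
  induction g using Finsupp.induction_linear with
  | zero => simp
  | add g₁ g₂ h₁ h₂ => rw [map_add, map_add, map_add, smul_add, ← h₁, ← h₂]; noncomm_ring
  | single e a =>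
    simp only [formalDeriv, Finsupp.linearCombination_single, map_smul, mul_smul_comm,
      smul_mul_assoc, ← smul_sub]
    rw [h.dualGen_mul_mon_sub, mul_smul, smul_comm a (genSign w), Nat.cast_smul_eq_nsmul,
      Nat.cast_smul_eq_nsmul]

variable (b : Fin n → Fin p) {f : Fin m → M}

theorem dualGen_mem_filtration {r : Fin p → ℕ} {y : M}
    (hy : y ∈ filtration X D (Sum.elim b b) f r) (w : Fin n ⊕ Fin n) :
    dualGen X D w y ∈
      filtration X D (Sum.elim b b) f (r + Pi.single ((Sum.elim b b : _ → Fin p) w) 1) := by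
  cases w with
  | inl k => exact h.gen_mem_filtration hy (Sum.inr k)
  | inr k => exact h.gen_mem_filtration hy (Sum.inl k)

theorem mon_apply_mem_filtration {c : Fin n ⊕ Fin n → Fin p} {r : Fin p → ℕ} {y : M}
    (hy : y ∈ filtration X D c f r) (e : Fin n ⊕ Fin n → ℕ) :
    mon X D e y ∈ filtration X D c f (r + blockDeg c e) := by
  -- Induction on `e`, phrased as an upper set containing `0`. Factors `X k` are added on the left
  -- and `D k` on the right, so monomials stay normally ordered; the latter case changes `y` and
  -- `r`, which are therefore quantified.
  have hup : IsUpperSet {e | ∀ r, ∀ y ∈ filtration X D c f r,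
      mon X D e y ∈ filtration X D c f (r + blockDeg c e)} := by
    refine isUpperSet_of_add_single fun e he w r y hy => ?_
    rw [blockDeg_add, blockDeg_single]
    cases w with
    | inl k =>
      rw [← h.x_mul_mon, Module.End.mul_apply, ← add_assoc]
      exact h.gen_mem_filtration (he r y hy) (Sum.inl k)
    | inr k =>
      rw [← h.mon_mul_d, Module.End.mul_apply, add_comm (blockDeg c e), ← add_assoc]
      exact he _ _ (h.gen_mem_filtration hy (Sum.inr k))
  refine hup (a := 0) zero_le (fun r y hy => ?_) r y hy
  have h0 : blockDeg c (0 : Fin n ⊕ Fin n → ℕ) = 0 := by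
    ext j
    simp [blockDeg]
  simpa [h0] using hy

variable [CharZero K]

/-- A nonzero combination of monomials of multidegree at most `d` does not annihilate the `d`-th
piece of the filtration. -/
theorem exists_linearCombination_mon_ne_zero (hf : ∃ i, f i ≠ 0)
    {g : (Fin n ⊕ Fin n → ℕ) →₀ K} (hg : g ≠ 0) (d : Fin p → ℕ)
    (hd : ∀ e ∈ g.support, blockDeg (Sum.elim b b) e ≤ d) :
    ∃ y ∈ filtration X D (Sum.elim b b) f d,
      Finsupp.linearCombination K (mon X D) g y ≠ 0 := by
  obtain ⟨t, ht⟩ : ∃ t, ∀ e ∈ g.support, ∑ w, e w ≤ t :=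
    ⟨g.support.sup fun e => ∑ w, e w, fun e he => Finset.le_sup (f := fun e => ∑ w, e w) he⟩
  induction t generalizing g d with
  | zero =>
    obtain ⟨i, hi⟩ := hf
    have hg0 : g = Finsupp.single 0 (g 0) := by
      refine Finsupp.ext fun e => ?_
      rw [Finsupp.single_apply]
      split_ifs with he
      · rw [he]
      · by_contra hge
        refine he (funext fun w => ?_)
        have := ht e (Finsupp.mem_support_iff.2 hge)
        simp only [nonpos_iff_eq_zero, Finset.sum_eq_zero_iff, Finset.mem_univ, true_imp_iff] at this
        exact (this w).symm
    refine ⟨f i, generator_mem_filtration d i, ?_⟩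
    have hg00 : g 0 ≠ 0 := fun h0 => hg (by rw [hg0, h0, Finsupp.single_zero])
    rw [hg0, Finsupp.linearCombination_single, mon_zero, LinearMap.smul_apply,
      Module.End.one_apply]
    exact smul_ne_zero hg00 hi
  | succ t ih =>
    by_cases hg0 : ∀ e ∈ g.support, ∑ w, e w ≤ t
    · exact ih hg d hd hg0
    push Not at hg0
    obtain ⟨e, he, het⟩ := hg0
    obtain ⟨w, -, hw⟩ : ∃ w ∈ Finset.univ, e w ≠ 0 :=
      Finset.exists_ne_zero_of_sum_ne_zero (by omega)
    have hsupp (e' : Fin n ⊕ Fin n → ℕ) (he' : e' ∈ (formalDeriv K n w g).support) :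
        e' + Pi.single w 1 ∈ g.support := by
      rw [Finsupp.mem_support_iff, formalDeriv_apply] at he'
      exact Finsupp.mem_support_iff.2 (right_ne_zero_of_mul he')
    -- The coefficient at `e - Pi.single w 1` is `e w` times that of `e`, nonzero in characteristic
    -- zero.
    have hne : formalDeriv K n w g ≠ 0 := by
      intro h0
      have h1 := congrArg (fun g => g (e - Pi.single w 1)) h0
      have h2 : e - Pi.single w 1 + Pi.single w 1 = e := by
        refine tsub_add_cancel_of_le fun w' => ?_
        obtain rfl | hw' := eq_or_ne w' w
        · simpa using Nat.one_le_iff_ne_zero.2 hw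
        · simp [hw']
      simp only [formalDeriv_apply, h2, Finsupp.coe_zero, Pi.zero_apply, mul_eq_zero] at h1
      refine h1.elim (fun h1 => ?_) (Finsupp.mem_support_iff.1 he)
      exact Nat.cast_add_one_ne_zero _ h1
    set δ : Fin p → ℕ := Pi.single ((Sum.elim b b : _ → Fin p) w) 1 with hδ
    obtain ⟨y, hy, hne'⟩ := ih hne (d - δ)
      (fun e' he' => by
        have := hd _ (hsupp e' he')
        rw [blockDeg_add, blockDeg_single] at this
        exact le_tsub_of_add_le_right this)
      (fun e' he' => by
        have := ht _ (hsupp e' he')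
        simp only [Pi.add_apply, Finset.sum_add_distrib, Finset.sum_pi_single', Finset.mem_univ,
          if_true] at this
        simpa using this)
    have hle : d - δ + δ = d := by
      refine tsub_add_cancel_of_le (le_trans ?_ (hd e he))
      rw [hδ, ← blockDeg_single]
      refine blockDeg_mono _ fun w' => ?_
      obtain rfl | hw' := eq_or_ne w' w
      · simpa using Nat.one_le_iff_ne_zero.2 hw
      · simp [hw']
    -- If `g` killed the `d`-th piece, both terms of its commutator with `dualGen X D w` would
    -- vanish on `y`, which lies in the piece `d - δ`; so its derivative would kill `y`.
    by_contra! hall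
    refine hne' (genSign_smul_eq_zero (w := w) ?_)
    rw [← LinearMap.smul_apply, ← h.dualGen_mul_linearCombination_sub, LinearMap.sub_apply,
      Module.End.mul_apply, Module.End.mul_apply, hall y (filtration_mono tsub_le_self hy),
      hall _ (hle ▸ h.dualGen_mem_filtration b hy w), map_zero, sub_zero]

/-- The monomials in `B` are linearly independent as maps from the `d`-th to the `(d + d)`-th piece,
and the space of such maps has the product of the two dimensions as its dimension. -/
theorem card_le_finrank_mul_finrank (hf : ∃ i, f i ≠ 0) (d : Fin p → ℕ)
    (B : Finset (Fin n ⊕ Fin n → ℕ)) (hB : ∀ e ∈ B, blockDeg (Sum.elim b b) e ≤ d) :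
    B.card ≤ Module.finrank K (filtration X D (Sum.elim b b) f d) *
      Module.finrank K (filtration X D (Sum.elim b b) f (d + d)) := by
  let φ (e : B) : filtration X D (Sum.elim b b) f d →ₗ[K]
      filtration X D (Sum.elim b b) f (d + d) :=
    (mon X D e.1).restrict fun y hy =>
      filtration_mono (add_le_add_right (hB e.1 e.2) d) (h.mon_apply_mem_filtration hy e.1)
  have hli : LinearIndependent K φ := by
    rw [linearIndependent_iff]
    intro l hl
    by_contra hne
    have hne' : l.mapDomain Subtype.val ≠ 0 := fun h0 =>
      hne (Finsupp.mapDomain_injective Subtype.val_injective (by rw [h0, Finsupp.mapDomain_zero]))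
    obtain ⟨y, hy, hy'⟩ := h.exists_linearCombination_mon_ne_zero b hf hne' d fun e he => by
      obtain ⟨e', -, rfl⟩ := Finset.mem_image.1 (Finsupp.mapDomain_support he)
      exact hB _ e'.2
    refine hy' ?_
    have := congrArg (fun ψ => ((ψ ⟨y, hy⟩ : filtration X D (Sum.elim b b) f (d + d)) : M)) hl
    rw [Finsupp.linearCombination_mapDomain]
    simpa [Finsupp.linearCombination_apply, Finsupp.sum, LinearMap.sum_apply, φ,
      LinearMap.restrict_apply] using this
  have := hli.fintype_card_le_finrank
  rwa [Module.finrank_linearMap, Fintype.card_coe] at this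

/-- Bernstein's inequality for the variables in the blocks in `J`. -/
theorem pow_le_finrank_mul_finrank (hf : ∃ i, f i ≠ 0) (J : Finset (Fin p)) (q : ℕ) :
    (q + 1) ^ (2 * (Finset.univ.filter fun k => b k ∈ J).card) ≤
      Module.finrank K (filtration X D (Sum.elim b b) f
        (fun j => if j ∈ J then 2 * n * q else 0)) *
      Module.finrank K (filtration X D (Sum.elim b b) f
        (fun j => if j ∈ J then 2 * (2 * n * q) else 0)) := by
  set c : Fin n ⊕ Fin n → Fin p := Sum.elim b b with hc
  -- The box of exponents at most `q` in the blocks of `J` and zero elsewhere. With `2 * n`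
  -- generators in all, every block degree is at most `2 * n * q`.
  let B : Finset (Fin n ⊕ Fin n → ℕ) :=
    Fintype.piFinset fun w => Finset.range (if c w ∈ J then q + 1 else 1)
  have hcard : B.card = (q + 1) ^ (2 * (Finset.univ.filter fun k => b k ∈ J).card) := by
    rw [← card_filter_sumElim_self b (· ∈ J)]
    simp only [B, Fintype.card_piFinset, Finset.card_range, hc, Finset.prod_ite,
      Finset.prod_const, one_pow, mul_one]
  rw [← hcard]
  have hdd : (fun j => if j ∈ J then 2 * (2 * n * q) else 0) =
      (fun j => if j ∈ J then 2 * n * q else 0) + fun j => if j ∈ J then 2 * n * q else 0 := by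
    ext j
    simp only [Pi.add_apply]
    split_ifs <;> ring
  rw [hdd]
  refine h.card_le_finrank_mul_finrank b hf (fun j => if j ∈ J then 2 * n * q else 0) B ?_
  intro e he j
  simp only [B, Fintype.mem_piFinset, Finset.mem_range] at he
  dsimp only
  split_ifs with hj
  · calc blockDeg c e j ≤ ∑ w with c w = j, q := Finset.sum_le_sum fun w hw => by
          have := he w
          split_ifs at this <;> omega
      _ ≤ ∑ w : Fin n ⊕ Fin n, q :=
          Finset.sum_le_sum_of_subset (Finset.filter_subset _ _)
      _ = 2 * n * q := by
          rw [Finset.sum_const, Finset.card_univ, Fintype.card_sum, Fintype.card_fin, smul_eq_mul,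
            two_mul]
  · refine (Finset.sum_eq_zero fun w hw => ?_).le
    have := he w
    rw [hc, (Finset.mem_filter.1 hw).2, if_neg hj] at this
    omega

end formal

end WeylRelations

namespace WeylAlgebra

open WeylRelations

variable (K : Type*) [Field K] {n : ℕ}

/-! ### Modules over the Weyl algebra as modules with operators -/

theorem x_mul_x (k l : Fin n) : x K k * x K l = x K l * x K k := by
  apply Subtype.ext
  apply LinearMap.ext
  intro f
  exact mul_left_comm _ _ _

theorem d_mul_d (k l : Fin n) : d K k * d K l = d K l * d K k := by
  apply Subtype.ext
  apply LinearMap.ext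
  intro f
  have : ⁅(MvPolynomial.pderiv k : Derivation K (MvPolynomial (Fin n) K) (MvPolynomial (Fin n) K)),
      (MvPolynomial.pderiv l : Derivation K (MvPolynomial (Fin n) K) (MvPolynomial (Fin n) K))⁆ =
      0 := by
    apply MvPolynomial.derivation_ext
    intro i
    simp [Derivation.commutator_apply, MvPolynomial.pderiv_X, Pi.single_apply, apply_ite]
  have := congrArg (fun D => D f) this
  rw [Derivation.commutator_apply] at this
  exact sub_eq_zero.1 this

theorem d_mul_x (k l : Fin n) :
    d K k * x K l = x K l * d K k + if k = l then 1 else 0 := by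
  apply Subtype.ext
  apply LinearMap.ext
  intro f
  have h : MvPolynomial.pderiv k (MvPolynomial.X l * f) =
      MvPolynomial.X l * MvPolynomial.pderiv k f + if k = l then f else 0 := by
    rw [Derivation.leibniz, MvPolynomial.pderiv_X, Pi.single_apply, smul_eq_mul, smul_eq_mul]
    split_ifs <;> simp_all
  refine h.trans ?_
  split_ifs <;> rfl

variable (M : Type*) [AddCommGroup M] [Module (WeylAlgebra K n) M] [Module K M]
  [IsScalarTower K (WeylAlgebra K n) M]

/-- The action of the Weyl algebra on a module. -/
def action : WeylAlgebra K n →ₐ[K] Module.End K M := Algebra.lsmul K K M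

theorem weylRelations_action :
    WeylRelations (fun k : Fin n => action K M (x K k)) (fun k => action K M (d K k)) where
  x_commute k l := by
    rw [commute_iff_eq, ← map_mul, ← map_mul, x_mul_x]
  d_commute k l := by
    rw [commute_iff_eq, ← map_mul, ← map_mul, d_mul_d]
  d_mul_x_sub k l := by
    rw [sub_eq_iff_eq_add', ← map_mul, ← map_mul, d_mul_x, map_add]
    split_ifs
    · rw [map_one]
    · rw [map_zero]

variable {M}

theorem mon_action (e : Fin n ⊕ Fin n → ℕ) (y : M) :
    mon (fun k : Fin n => action K M (x K k)) (fun k => action K M (d K k)) e y =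
      monomial K (e ∘ Sum.inl) (e ∘ Sum.inr) • y := by
  have h : mon (fun k : Fin n => action K M (x K k)) (fun k => action K M (d K k)) e =
      action K M (monomial K (e ∘ Sum.inl) (e ∘ Sum.inr)) := by
    rw [mon, monomial, map_mul, map_list_prod, map_list_prod, List.map_ofFn, List.map_ofFn]
    simp only [Function.comp_def, map_pow]
  rw [h]
  rfl

variable {p m : ℕ}

/-- The filtration of a module over the Weyl algebra by multidegree. -/
abbrev moduleFiltration (b : Fin n → Fin p) (f : Fin m → M) (r : Fin p → ℕ) : Submodule K M :=
  filtration (fun k : Fin n => action K M (x K k)) (fun k => action K M (d K k)) (Sum.elim b b) f r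

theorem sumSmul_span (S : Set (WeylAlgebra K n)) (f : Fin m → M) (P : Submodule K M) :
    sumSmul K (Submodule.span K S) f ≤ P ↔ ∀ i, ∀ a ∈ S, a • f i ∈ P := by
  simp only [sumSmul, iSup_le_iff, Submodule.map_span_le]
  rfl

theorem blockDeg_sumElim_self (b : Fin n → Fin p) (e : Fin n ⊕ Fin n → ℕ) (j : Fin p) :
    blockDeg (Sum.elim b b) e j = blockOrd b j (e ∘ Sum.inl) (e ∘ Sum.inr) := by
  rw [blockDeg, Finset.sum_filter, Fintype.sum_sum_type, blockOrd, Finset.sum_add_distrib,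
    Finset.sum_filter, Finset.sum_filter]
  rfl

theorem eq_moduleFiltration_of_span {S : Set (WeylAlgebra K n)} (b : Fin n → Fin p) (f : Fin m → M)
    (r : Fin p → ℕ) (hS : ∀ a, a ∈ S ↔ ∃ e : Fin n ⊕ Fin n → ℕ, blockDeg (Sum.elim b b) e ≤ r ∧
      a = monomial K (e ∘ Sum.inl) (e ∘ Sum.inr)) :
    sumSmul K (Submodule.span K S) f = moduleFiltration K b f r := by
  apply le_antisymm
  · rw [sumSmul_span]
    intro i a ha
    obtain ⟨e, he, rfl⟩ := (hS a).1 ha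
    rw [← mon_action]
    exact mon_mem_filtration he i
  · refine filtration_le fun i e he => ?_
    rw [mon_action]
    exact (sumSmul_span K S f _).1 le_rfl i _ ((hS _).2 ⟨e, he, rfl⟩)

theorem multiM_eq_moduleFiltration (b : Fin n → Fin p) (f : Fin m → M) (r : Fin p → ℕ) :
    multiM K b f (fun j => (r j : ℤ)) = moduleFiltration K b f r := by
  refine eq_moduleFiltration_of_span K b f r fun a => ?_
  constructor
  · rintro ⟨α, β, h, rfl⟩
    refine ⟨Sum.elim α β, fun j => ?_, rfl⟩
    rw [blockDeg_sumElim_self]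
    exact Nat.cast_le.1 (h j)
  · rintro ⟨e, he, rfl⟩
    refine ⟨_, _, fun j => ?_, rfl⟩
    rw [← blockDeg_sumElim_self]
    exact Nat.cast_le.2 (he j)

/-- The Bernstein filtration is the filtration for the partition into a single block. -/
theorem bernstein_eq_moduleFiltration (f : Fin m → M) (r : ℕ) :
    sumSmul K (bernsteinW K n (r : ℤ)) f =
      moduleFiltration K (fun _ : Fin n => (0 : Fin 1)) f (fun _ => r) := by
  have hord (α β : Fin n → ℕ) (j : Fin 1) : blockOrd (fun _ => (0 : Fin 1)) j α β = ord α β := by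
    rw [blockOrd, ord, Finset.filter_true_of_mem fun k _ => Subsingleton.elim _ _]
  refine eq_moduleFiltration_of_span K _ f _ fun a => ?_
  constructor
  · rintro ⟨α, β, h, rfl⟩
    refine ⟨Sum.elim α β, fun j => ?_, rfl⟩
    rw [blockDeg_sumElim_self, hord]
    exact_mod_cast h
  · rintro ⟨e, he, rfl⟩
    refine ⟨_, _, ?_, rfl⟩
    rw [← hord _ _ 0, ← blockDeg_sumElim_self]
    exact_mod_cast he 0

/-! ### Comparison of filtrations -/

/-- The union of the filtration is the submodule generated by the generators. -/
theorem exists_mem_moduleFiltration (b : Fin n → Fin p) (f : Fin m → M) {y : M}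
    (hy : y ∈ Submodule.span (WeylAlgebra K n) (Set.range f)) :
    ∃ r, y ∈ moduleFiltration K b f r := by
  have hrel := weylRelations_action K (n := n) M
  have hdir : Directed (· ≤ ·) (moduleFiltration K b f) := fun r r' =>
    ⟨r ⊔ r', filtration_mono le_sup_left, filtration_mono le_sup_right⟩
  let U : Submodule K M := ⨆ r, moduleFiltration K b f r
  have hU {y : M} : y ∈ U ↔ ∃ r, y ∈ moduleFiltration K b f r :=
    Submodule.mem_iSup_of_directed _ hdir
  -- It suffices to check stability of the union under the algebra generators, each of which raises
  -- the bound by one in a single block.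
  have hgen (a : Module.End K (MvPolynomial (Fin n) K)) (ha : a ∈ weylSubalgebra K n) :
      ∀ y ∈ U, action K M (⟨a, ha⟩ : WeylAlgebra K n) y ∈ U := by
    induction ha using Algebra.adjoin_induction with
    | mem a ha =>
      intro y hy
      obtain ⟨r, hr⟩ := hU.1 hy
      rcases ha with ⟨k, rfl⟩ | ⟨k, rfl⟩
      · exact hU.2 ⟨_, hrel.gen_mem_filtration hr (Sum.inl k)⟩
      · exact hU.2 ⟨_, hrel.gen_mem_filtration hr (Sum.inr k)⟩
    | algebraMap a =>
      intro y hy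
      have : action K M (⟨algebraMap K _ a, Subalgebra.algebraMap_mem _ a⟩ : WeylAlgebra K n) =
          a • 1 := ((action K M).commutes a).trans (Algebra.algebraMap_eq_smul_one a)
      rw [this]
      exact U.smul_mem a hy
    | add a b ha hb iha ihb =>
      intro y hy
      have := map_add (action K M) (⟨a, ha⟩ : WeylAlgebra K n) ⟨b, hb⟩
      exact (congrArg (fun φ => φ y) this).symm ▸ add_mem (iha y hy) (ihb y hy)
    | mul a b ha hb iha ihb =>
      intro y hy
      have := map_mul (action K M) (⟨a, ha⟩ : WeylAlgebra K n) ⟨b, hb⟩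
      exact (congrArg (fun φ => φ y) this).symm ▸ iha _ (ihb y hy)
  rw [← hU]
  induction hy using Submodule.span_induction with
  | mem y hy =>
    obtain ⟨i, rfl⟩ := hy
    exact hU.2 ⟨0, generator_mem_filtration 0 i⟩
  | zero => exact zero_mem U
  | add y z _ _ hy hz => exact add_mem hy hz
  | smul a y _ hy => exact hgen a.1 a.2 y hy

/-- If the generators `f` generate the module, every other filtration is contained in a translate
of the filtration defined by `f`. -/
theorem exists_moduleFiltration_le (b : Fin n → Fin p) (f : Fin m → M)
    (hf : Submodule.span (WeylAlgebra K n) (Set.range f) = ⊤) {q : ℕ} (g : Fin q → M) :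
    ∃ s, ∀ r, moduleFiltration K b g r ≤ moduleFiltration K b f (s + r) := by
  choose s hs using fun i => exists_mem_moduleFiltration K b f (y := g i) (hf ▸ Submodule.mem_top)
  refine ⟨Finset.univ.sup s, fun r => filtration_le fun i e he => ?_⟩
  refine filtration_mono ?_ ((weylRelations_action K M).mon_apply_mem_filtration (hs i) e)
  exact add_le_add (Finset.le_sup (Finset.mem_univ i)) he

theorem blockDeg_fin_one (b : Fin n → Fin p) (e : Fin n ⊕ Fin n → ℕ) (j : Fin 1) :
    blockDeg (Sum.elim (fun _ => (0 : Fin 1)) fun _ => 0) e j =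
      ∑ i, blockDeg (Sum.elim b b) e i := by
  simp only [blockDeg]
  rw [Finset.sum_fiberwise, Finset.filter_true_of_mem fun k _ => Subsingleton.elim _ _]

theorem bernstein_le_moduleFiltration (b : Fin n → Fin p) (f : Fin m → M) (r : ℕ) :
    moduleFiltration K (fun _ : Fin n => (0 : Fin 1)) f (fun _ => r) ≤
      moduleFiltration K b f (fun _ => r) := by
  refine filtration_le fun i e he => mon_mem_filtration (fun j => ?_) i
  refine le_trans ?_ (he 0)
  rw [blockDeg_fin_one b]
  exact Finset.single_le_sum (f := blockDeg (Sum.elim b b) e) (fun _ _ => Nat.zero_le _)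
    (Finset.mem_univ j)

theorem moduleFiltration_le_bernstein (b : Fin n → Fin p) (f : Fin m → M) (r : Fin p → ℕ) :
    moduleFiltration K b f r ≤
      moduleFiltration K (fun _ : Fin n => (0 : Fin 1)) f (fun _ => ∑ i, r i) := by
  refine filtration_le fun i e he => mon_mem_filtration (fun j => ?_) i
  rw [blockDeg_fin_one b]
  exact Finset.sum_le_sum fun i _ => he i

end WeylAlgebra

/-! ### Polynomials given by integer combinations of products of binomial coefficients -/

section binomPoly

variable {p : ℕ}

theorem eval_binomPoly (i : Fin p) (k : ℕ) (r : Fin p → ℕ) :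
    MvPolynomial.eval (fun j => (r j : ℚ)) (binomPoly i k) = ((r i + k).choose k : ℚ) := by
  rw [binomPoly, map_mul, MvPolynomial.eval_C, map_prod, inv_mul_eq_iff_eq_mul₀ (by positivity),
    ← Nat.cast_mul, ← Nat.ascFactorial_eq_factorial_mul_choose, Nat.ascFactorial_eq_prod_range,
    Nat.cast_prod]
  refine Finset.prod_congr rfl fun j _ => ?_
  simp
  ring

theorem degreeOf_binomPoly_le (i j : Fin p) (k : ℕ) :
    (binomPoly i k).degreeOf j ≤ if j = i then k else 0 := by
  refine (MvPolynomial.degreeOf_C_mul_le _ _ _).trans ((MvPolynomial.degreeOf_prod_le _ _ _).trans ?_)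
  calc _ ≤ ∑ _l ∈ Finset.range k, if j = i then 1 else 0 := by
        refine Finset.sum_le_sum fun l _ => (MvPolynomial.degreeOf_add_le _ _ _).trans ?_
        rw [MvPolynomial.degreeOf_C, MvPolynomial.degreeOf_X]
        simp
    _ = _ := by simp

theorem totalDegree_binomPoly_le (i : Fin p) (k : ℕ) : (binomPoly i k).totalDegree ≤ k := by
  refine (MvPolynomial.totalDegree_mul _ _).trans ?_
  rw [MvPolynomial.totalDegree_C, zero_add]
  refine (MvPolynomial.totalDegree_finsetProd _ _).trans ?_
  calc _ ≤ ∑ _l ∈ Finset.range k, 1 := by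
        refine Finset.sum_le_sum fun l _ => (MvPolynomial.totalDegree_add _ _).trans ?_
        rw [MvPolynomial.totalDegree_C, MvPolynomial.totalDegree_X]
        simp
    _ = _ := by simp

/-- The polynomial with coefficients `a` in the basis of products of binomial coefficients. -/
def binomCombination (N : Fin p → ℕ) (a : (Fin p → ℕ) → ℤ) : MvPolynomial (Fin p) ℚ :=
  ∑ k ∈ Fintype.piFinset (fun i => Finset.range (N i + 1)),
    MvPolynomial.C (a k : ℚ) * ∏ i, binomPoly i (k i)

variable (N : Fin p → ℕ) (a : (Fin p → ℕ) → ℤ)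

theorem eval_binomCombination (r : Fin p → ℕ) :
    MvPolynomial.eval (fun j => (r j : ℚ)) (binomCombination N a) =
      ((∑ k ∈ Fintype.piFinset (fun i => Finset.range (N i + 1)),
        a k * ∏ i, ((r i + k i).choose (k i) : ℤ) : ℤ) : ℚ) := by
  simp [binomCombination, eval_binomPoly]

theorem degreeOf_binomCombination_le (j : Fin p) : (binomCombination N a).degreeOf j ≤ N j := by
  refine (MvPolynomial.degreeOf_sum_le _ _ _).trans (Finset.sup_le fun k hk => ?_)
  refine (MvPolynomial.degreeOf_C_mul_le _ _ _).trans ((MvPolynomial.degreeOf_prod_le _ _ _).trans ?_)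
  refine (Finset.sum_le_sum fun i _ => degreeOf_binomPoly_le i j (k i)).trans ?_
  simpa [Nat.lt_succ_iff] using Fintype.mem_piFinset.1 hk j

theorem totalDegree_binomCombination_le : (binomCombination N a).totalDegree ≤ ∑ i, N i := by
  refine (MvPolynomial.totalDegree_finsetSum _ _).trans (Finset.sup_le fun k hk => ?_)
  refine (MvPolynomial.totalDegree_mul _ _).trans ?_
  rw [MvPolynomial.totalDegree_C, zero_add]
  refine (MvPolynomial.totalDegree_finsetProd _ _).trans (Finset.sum_le_sum fun i _ => ?_)
  exact (totalDegree_binomPoly_le i (k i)).trans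
    (Nat.lt_succ_iff.1 (Finset.mem_range.1 (Fintype.mem_piFinset.1 hk i)))

end binomPoly

/-! ### Restriction of polynomials to rays -/

section ray

variable {p : ℕ}

/-- The restriction of a polynomial to the ray from `s` in the direction `v`. -/
def rayPoly (φ : MvPolynomial (Fin p) ℚ) (s v : Fin p → ℕ) : Polynomial ℚ :=
  MvPolynomial.aeval (fun i => Polynomial.C (s i : ℚ) + Polynomial.C (v i : ℚ) * Polynomial.X) φ

theorem eval_rayPoly (φ : MvPolynomial (Fin p) ℚ) (s v : Fin p → ℕ) (q : ℕ) :
    (rayPoly φ s v).eval (q : ℚ) =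
      MvPolynomial.eval (fun i => ((s i + v i * q : ℕ) : ℚ)) φ := by
  rw [rayPoly, ← Polynomial.coe_evalRingHom, MvPolynomial.aeval_def, MvPolynomial.hom_eval₂,
    MvPolynomial.eval, MvPolynomial.coe_eval₂Hom]
  congr 1
  · exact Subsingleton.elim _ _
  · ext i
    simp

/-- Variables with `v i = 0` become constants on the ray, so only the others contribute to the
degree. -/
theorem natDegree_rayPoly_le_sum (φ : MvPolynomial (Fin p) ℚ) (s v : Fin p → ℕ) (t : ℕ)
    (h : ∀ m ∈ φ.support, ∑ i with v i ≠ 0, m i ≤ t) : (rayPoly φ s v).natDegree ≤ t := by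
  rw [rayPoly, MvPolynomial.aeval_def, MvPolynomial.eval₂_eq]
  refine Polynomial.natDegree_sum_le_of_forall_le _ _ fun m hm => ?_
  refine (Polynomial.natDegree_C_mul_le _ _).trans ((Polynomial.natDegree_prod_le _ _).trans ?_)
  calc _ ≤ ∑ i, if v i ≠ 0 then m i else 0 := by
        refine (Finset.sum_le_sum_of_subset (Finset.subset_univ _)).trans
          (Finset.sum_le_sum fun i _ => Polynomial.natDegree_pow_le.trans ?_)
        split_ifs with hv
        · refine (Nat.mul_le_mul_left _ ?_).trans (mul_one _).le
          compute_degree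
        · rw [not_not] at hv
          simp [hv]
    _ = ∑ i with v i ≠ 0, m i := (Finset.sum_filter _ _).symm
    _ ≤ t := h m hm

theorem natDegree_rayPoly_le (φ : MvPolynomial (Fin p) ℚ) (s v : Fin p → ℕ) :
    (rayPoly φ s v).natDegree ≤ φ.totalDegree := by
  refine natDegree_rayPoly_le_sum φ s v _ fun m hm => ?_
  refine le_trans ?_ (MvPolynomial.le_totalDegree hm)
  rw [Finsupp.sum_fintype _ _ fun _ => rfl]
  exact Finset.sum_le_sum_of_subset (Finset.filter_subset _ _)

theorem natDegree_rayPoly_le_degreeOf (φ : MvPolynomial (Fin p) ℚ) (s v : Fin p → ℕ) (i : Fin p)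
    (hv : ∀ j, j ≠ i → v j = 0) : (rayPoly φ s v).natDegree ≤ φ.degreeOf i := by
  refine natDegree_rayPoly_le_sum φ s v _ fun m hm => ?_
  refine le_trans ?_ (MvPolynomial.monomial_le_degreeOf i hm)
  refine (Finset.sum_le_sum_of_subset (t := {i}) fun j hj => ?_).trans (by simp)
  by_contra hji
  exact (Finset.mem_filter.1 hj).2 (hv j (by simpa using hji))

/-- On a line through the origin, the homogeneous component of degree `t` restricts to a multiple of
`X ^ t`. -/
theorem coeff_rayPoly_zero (φ : MvPolynomial (Fin p) ℚ) (v : Fin p → ℕ) (t : ℕ) :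
    (rayPoly φ 0 v).coeff t =
      MvPolynomial.eval (fun i => (v i : ℚ)) (MvPolynomial.homogeneousComponent t φ) := by
  induction φ using MvPolynomial.induction_on' with
  | add φ ψ hφ hψ =>
    rw [rayPoly] at hφ hψ ⊢
    rw [map_add, Polynomial.coeff_add, hφ, hψ, map_add, map_add]
  | monomial m a =>
    rw [MvPolynomial.homogeneousComponent_of_mem (MvPolynomial.isHomogeneous_monomial a rfl),
      rayPoly, MvPolynomial.aeval_monomial]
    have : (m.prod fun i k => (Polynomial.C ((0 : Fin p → ℕ) i : ℚ) +
        Polynomial.C (v i : ℚ) * Polynomial.X) ^ k) =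
        Polynomial.C (m.prod fun i k => (v i : ℚ) ^ k) * Polynomial.X ^ m.degree := by
      simp [mul_pow, Finsupp.prod, Finset.prod_mul_distrib, Finset.prod_pow_eq_pow_sum,
        Finsupp.degree_apply]
    rw [this, ← mul_assoc, Polynomial.algebraMap_eq, ← Polynomial.C_mul,
      Polynomial.coeff_C_mul_X_pow]
    split_ifs with ht
    · rw [MvPolynomial.eval_monomial]
    · simp

/-- The total degree of a polynomial is attained on a ray with positive direction. -/
theorem exists_totalDegree_le_natDegree_rayPoly {φ : MvPolynomial (Fin p) ℚ} (hφ : φ ≠ 0) :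
    ∃ v : Fin p → ℕ, (∀ i, 0 < v i) ∧ φ.totalDegree ≤ (rayPoly φ 0 v).natDegree := by
  by_contra! hall
  have hzero : MvPolynomial.homogeneousComponent φ.totalDegree φ = 0 := by
    -- If the degree dropped on every positive ray, the top homogeneous component would vanish at
    -- all positive integer points, a product of infinite sets.
    refine MvPolynomial.funext_set (fun _ => Set.range fun t : ℕ => ((t + 1 : ℕ) : ℚ))
      (fun _ => Set.infinite_range_of_injective fun a b h => ?_) fun x hx => ?_
    · simpa using h
    · choose t ht using fun i => hx i (Set.mem_univ i)
      have h1 := Polynomial.coeff_eq_zero_of_natDegree_lt (hall (fun i => t i + 1) fun i => by simp)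
      rw [coeff_rayPoly_zero] at h1
      rw [map_zero, ← h1]
      congr 2
      ext i
      exact (ht i).symm
  obtain ⟨m, hm, hdeg⟩ := Finset.exists_mem_eq_sup _ (MvPolynomial.support_nonempty.2 hφ)
    fun m : Fin p →₀ ℕ => m.sum fun _ e => e
  refine MvPolynomial.mem_support_iff.1 hm ?_
  have h2 := congrArg (MvPolynomial.coeff m) hzero
  rw [MvPolynomial.coeff_homogeneousComponent, if_pos, MvPolynomial.coeff_zero] at h2
  · exact h2
  · rw [MvPolynomial.totalDegree, hdeg]
    rfl

end ray

/-- A polynomial bounded by another one at large integers has at most its degree. -/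
theorem Polynomial.natDegree_le_of_eventually_le {P Q : Polynomial ℚ} (r₀ : ℕ)
    (h : ∀ r : ℕ, r₀ ≤ r → 0 < P.eval (r : ℚ) ∧ P.eval (r : ℚ) ≤ Q.eval (r : ℚ)) :
    P.natDegree ≤ Q.natDegree := by
  by_contra! hlt
  have ht := (Polynomial.div_tendsto_atTop_zero_of_degree_lt Q P
    (Polynomial.degree_lt_degree hlt)).comp (tendsto_natCast_atTop_atTop (R := ℚ))
  obtain ⟨r, h1, h2⟩ := ((ht.eventually (gt_mem_nhds one_pos)).and
    (Filter.eventually_ge_atTop r₀)).exists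
  obtain ⟨hpos, hle⟩ := h r h2
  rw [Function.comp_apply, div_lt_one hpos] at h1
  exact absurd hle (not_le.2 h1)

theorem Submodule.exists_ne_zero_of_span_eq_top {R M ι : Type*} [Semiring R] [AddCommMonoid M]
    [Module R M] [Nontrivial M] {f : ι → M} (hf : Submodule.span R (Set.range f) = ⊤) :
    ∃ i, f i ≠ 0 := by
  by_contra! h
  have : Set.range f ⊆ {0} := by
    rintro _ ⟨i, rfl⟩
    exact h i
  rw [Submodule.span_eq_bot.2 fun y hy => this hy] at hf
  exact bot_ne_top hf

/-! ### Dimension polynomials: existence, degree bounds, comparison with Bernstein polynomials -/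

namespace WeylAlgebra

open WeylRelations

variable (K : Type*) [Field K] {n p m : ℕ} {M : Type*} [AddCommGroup M]
  [Module (WeylAlgebra K n) M] [Module K M] [IsScalarTower K (WeylAlgebra K n) M]

/-- `φ` is the dimension polynomial of the filtration defined by the blocks `b` and the generators
`f`. -/
def IsDimensionPolynomial (b : Fin n → Fin p) (f : Fin m → M) (φ : MvPolynomial (Fin p) ℚ) : Prop :=
  ∃ s : Fin p → ℕ, ∀ r, s ≤ r →
    MvPolynomial.eval (fun i => (r i : ℚ)) φ = (Module.finrank K (moduleFiltration K b f r) : ℚ)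

theorem exists_isDimensionPolynomial (b : Fin n → Fin p) (f : Fin m → M) :
    ∃ a : (Fin p → ℕ) → ℤ,
      IsDimensionPolynomial K b f (binomCombination (fun i => 2 * blockSize b i) a) := by
  obtain ⟨a, s, h⟩ := (weylRelations_action K (n := n) M).eventuallyBinomial_finrank_filtration
    (Sum.elim b b) f
  have hN (i : Fin p) := card_filter_sumElim_self b (· = i)
  simp only [hN] at h
  refine ⟨a, s, fun r hr => ?_⟩
  rw [eval_binomCombination]
  exact_mod_cast (h r hr).symm

theorem sum_blockSize (b : Fin n → Fin p) : ∑ i, blockSize b i = n := by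
  simp only [blockSize]
  rw [← Finset.card_eq_sum_card_fiberwise fun _ _ => Finset.mem_coe.2 (Finset.mem_univ _)]
  simp

theorem finrank_moduleFiltration_pos (b : Fin n → Fin p) {f : Fin m → M} (hf : ∃ i, f i ≠ 0)
    (r : Fin p → ℕ) : 0 < Module.finrank K (moduleFiltration K b f r) := by
  obtain ⟨i, hi⟩ := hf
  have : Nontrivial (moduleFiltration K b f r) :=
    ⟨⟨f i, generator_mem_filtration r i⟩, 0, fun h => hi (congrArg Subtype.val h)⟩
  exact Module.finrank_pos

namespace IsDimensionPolynomial

variable {K} {b : Fin n → Fin p} {f : Fin m → M} {φ : MvPolynomial (Fin p) ℚ}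

theorem ne_zero (h : IsDimensionPolynomial K b f φ) (hf : ∃ i, f i ≠ 0) : φ ≠ 0 := by
  rintro rfl
  obtain ⟨s, h⟩ := h
  have := h s le_rfl
  rw [map_zero, eq_comm, Nat.cast_eq_zero] at this
  exact (finrank_moduleFiltration_pos K b hf s).ne' this

/-- Bernstein's inequality for the restriction of the dimension polynomial to the blocks in `J`. -/
theorem card_le_of_natDegree_rayPoly_le [CharZero K] (h : IsDimensionPolynomial K b f φ)
    (hf : ∃ i, f i ≠ 0) (J : Finset (Fin p)) {t : ℕ}
    (ht : ∀ s v, (∀ i ∉ J, v i = 0) → (rayPoly φ s v).natDegree ≤ t) :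
    (Finset.univ.filter fun k => b k ∈ J).card ≤ t := by
  obtain ⟨s, h⟩ := h
  let v (a : ℕ) (i : Fin p) : ℕ := if i ∈ J then a else 0
  have hv (a : ℕ) : ∀ i ∉ J, v a i = 0 := fun i hi => if_neg hi
  -- The inequality for pieces supported on `J` is enlarged by monotonicity to rays based at `s`,
  -- where `φ` computes dimensions. Comparing degrees in `q` gives twice the cardinality at most `2
  -- * t`.
  have hdeg := Polynomial.natDegree_le_of_eventually_le 0
    (P := (Polynomial.X + Polynomial.C 1) ^ (2 * (Finset.univ.filter fun k => b k ∈ J).card))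
    (Q := rayPoly φ s (v (2 * n)) * rayPoly φ s (v (2 * (2 * n)))) fun q _ => by
      have hle (a c : ℕ) (hc : a * q = c) : Module.finrank K
          (moduleFiltration K b f fun i => if i ∈ J then c else 0) ≤
          Module.finrank K (moduleFiltration K b f fun i => s i + v a i * q) :=
        Submodule.finrank_mono (filtration_mono fun i => by
          by_cases hi : i ∈ J <;> simp [v, hi, hc])
      have hB := ((weylRelations_action K M).pow_le_finrank_mul_finrank b hf J q).trans
        (Nat.mul_le_mul (hle (2 * n) _ rfl) (hle (2 * (2 * n)) _ (mul_assoc _ _ _)))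
      rw [Polynomial.eval_mul, eval_rayPoly, eval_rayPoly, h _ fun _ => Nat.le_add_right _ _,
        h _ fun _ => Nat.le_add_right _ _]
      rw [Polynomial.eval_pow, Polynomial.eval_add, Polynomial.eval_X, Polynomial.eval_C]
      exact ⟨by positivity, by exact_mod_cast hB⟩
  rw [Polynomial.natDegree_pow, Polynomial.natDegree_X_add_C, mul_one] at hdeg
  have := hdeg.trans (Polynomial.natDegree_mul_le.trans
    (add_le_add (ht s _ (hv _)) (ht s _ (hv _))))
  omega

theorem blockSize_le_degreeOf [CharZero K] (h : IsDimensionPolynomial K b f φ)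
    (hf : ∃ i, f i ≠ 0) (i : Fin p) : blockSize b i ≤ φ.degreeOf i := by
  have := h.card_le_of_natDegree_rayPoly_le hf {i} (t := φ.degreeOf i) fun s v hv =>
    natDegree_rayPoly_le_degreeOf φ s v i fun j hj => hv j (by simpa using hj)
  simpa [blockSize] using this

theorem le_totalDegree [CharZero K] (h : IsDimensionPolynomial K b f φ)
    (hf : ∃ i, f i ≠ 0) : n ≤ φ.totalDegree := by
  have := h.card_le_of_natDegree_rayPoly_le hf Finset.univ (t := φ.totalDegree) fun s v _ =>
    natDegree_rayPoly_le φ s v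
  simpa using this

/-- The total degree of the dimension polynomial is the degree of the Bernstein polynomial of any
system of generators. -/
theorem totalDegree_eq [Nontrivial M] (h : IsDimensionPolynomial K b f φ)
    (hf : Submodule.span (WeylAlgebra K n) (Set.range f) = ⊤) {q : ℕ} {g : Fin q → M}
    (hg : Submodule.span (WeylAlgebra K n) (Set.range g) = ⊤) {ψ : Polynomial ℚ}
    (hψ : IsBernsteinPolynomial K (n := n) g ψ) : φ.totalDegree = ψ.natDegree := by
  have hf0 := Submodule.exists_ne_zero_of_span_eq_top hf
  have hg0 := Submodule.exists_ne_zero_of_span_eq_top hg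
  have hφ := h.ne_zero hf0
  obtain ⟨s, h⟩ := h
  obtain ⟨r₀, hψ⟩ := hψ
  have hψ' (r : ℕ) (hr : r₀.toNat ≤ r) : ψ.eval (r : ℚ) =
      (Module.finrank K (moduleFiltration K (fun _ : Fin n => (0 : Fin 1)) g fun _ => r) : ℚ) := by
    rw [← bernstein_eq_moduleFiltration, ← hψ _ (by omega), Int.cast_natCast]
  apply le_antisymm
  -- Positivity of `v` ensures that the ray from the origin eventually dominates `s`.
  · obtain ⟨v, hv, hle⟩ := exists_totalDegree_le_natDegree_rayPoly hφ
    refine hle.trans ?_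
    obtain ⟨s', hs'⟩ := exists_moduleFiltration_le K (fun _ : Fin n => (0 : Fin 1)) g hg f
    -- The Bernstein index containing the block piece at `r • v`: the sum of the bounds, plus the
    -- shift `s' 0` from `f` to `g`, plus `r₀` so that `ψ` is valid there. As `P` is linear,
    -- composition does not raise the degree.
    set P : Polynomial ℚ := Polynomial.C ((∑ i, v i : ℕ) : ℚ) * Polynomial.X +
      Polynomial.C ((s' 0 + r₀.toNat : ℕ) : ℚ) with hP
    have hcomp : (ψ.comp P).natDegree ≤ ψ.natDegree := by
      rw [Polynomial.natDegree_comp]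
      refine (Nat.mul_le_mul_left _ ?_).trans (mul_one _).le
      rw [hP]
      compute_degree
    refine le_trans (Polynomial.natDegree_le_of_eventually_le (∑ i, s i) fun r hr => ?_) hcomp
    have hs : s ≤ fun i => (0 : Fin p → ℕ) i + v i * r := fun i => by
      have h1 : s i ≤ ∑ i, s i := Finset.single_le_sum (fun _ _ => Nat.zero_le _) (Finset.mem_univ i)
      have h2 : r ≤ v i * r := Nat.le_mul_of_pos_left r (hv i)
      simp only [Pi.zero_apply, zero_add]
      omega
    have hPr : P.eval (r : ℚ) = (((∑ i, v i) * r + (s' 0 + r₀.toNat) : ℕ) : ℚ) := by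
      simp only [hP, Polynomial.eval_add, Polynomial.eval_mul, Polynomial.eval_C, Polynomial.eval_X]
      push_cast
      ring
    rw [eval_rayPoly, h _ hs, Polynomial.eval_comp, hPr, hψ' _ (by omega), Nat.cast_pos,
      Nat.cast_le]
    refine ⟨finrank_moduleFiltration_pos K b hf0 _, Submodule.finrank_mono ?_⟩
    refine (moduleFiltration_le_bernstein K b f _).trans ((hs' _).trans (filtration_mono ?_))
    intro j
    rw [Subsingleton.elim j 0]
    simp only [Pi.add_apply, Pi.zero_apply, zero_add, Finset.sum_mul]
    omega
  -- Conversely, the Bernstein piece of index `r` lies in the block piece at `(r, …, r)` shifted by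
  -- `s'`, so `ψ` is bounded by `φ` on a diagonal ray.
  · obtain ⟨s', hs'⟩ := exists_moduleFiltration_le K b f hf g
    refine le_trans (Polynomial.natDegree_le_of_eventually_le r₀.toNat fun r hr => ?_)
      (natDegree_rayPoly_le φ (s + s') 1)
    rw [eval_rayPoly, h _ fun i => by simp only [Pi.add_apply]; omega, hψ' r hr, Nat.cast_pos,
      Nat.cast_le]
    refine ⟨finrank_moduleFiltration_pos K _ hg0 _, Submodule.finrank_mono ?_⟩
    refine (bernstein_le_moduleFiltration K b g r).trans ((hs' _).trans (filtration_mono ?_))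
    intro i
    simp only [Pi.add_apply, Pi.one_apply]
    omega

end IsDimensionPolynomial

/-- The one-block case of the dimension polynomial, read as a polynomial in one variable. -/
theorem exists_isBernsteinPolynomial (f : Fin m → M) :
    ∃ ψ : Polynomial ℚ, IsBernsteinPolynomial K (n := n) f ψ := by
  obtain ⟨a, s, h⟩ := exists_isDimensionPolynomial K (fun _ : Fin n => (0 : Fin 1)) f
  refine ⟨rayPoly (binomCombination (fun i => 2 * blockSize (fun _ : Fin n => (0 : Fin 1)) i) a) 0 1, s 0, fun r hr => ?_⟩
  lift r to ℕ using (Int.natCast_nonneg _).trans hr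
  rw [Int.cast_natCast, bernstein_eq_moduleFiltration, eval_rayPoly]
  simp only [Pi.zero_apply, zero_add, Pi.one_apply, one_mul]
  exact h _ fun j => by
    rw [Subsingleton.elim j 0]
    exact_mod_cast hr

end WeylAlgebra

theorem theorem4p2 {K : Type*} [Field K] [CharZero K] {n p m : ℕ} (b : Fin n → Fin p)
    {M : Type*} [AddCommGroup M] [Module (WeylAlgebra K n) M] [Module K M]
    [IsScalarTower K (WeylAlgebra K n) M] [Nontrivial M]
    (f : Fin m → M) (hf : Submodule.span (WeylAlgebra K n) (Set.range f) = ⊤) :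
    ∃ φ : MvPolynomial (Fin p) ℚ, φ ≠ 0 ∧ IsNumerical φ ∧
      (∃ s : Fin p → ℤ, ∀ r : Fin p → ℤ, s ≤ r →
        Module.Finite K ↥(WeylAlgebra.multiM K b f r) ∧
        MvPolynomial.eval (fun i => (r i : ℚ)) φ =
          (Module.finrank K ↥(WeylAlgebra.multiM K b f r) : ℚ)) ∧
      (∀ i : Fin p, blockSize b i ≤ φ.degreeOf i ∧ φ.degreeOf i ≤ 2 * blockSize b i) ∧
      (n ≤ φ.totalDegree ∧ φ.totalDegree ≤ 2 * n) ∧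
      (∃ a : (Fin p → ℕ) → ℤ,
        φ = ∑ k ∈ Fintype.piFinset (fun i => Finset.range (2 * blockSize b i + 1)),
          MvPolynomial.C (a k : ℚ) * ∏ i, binomPoly i (k i)) ∧
      (WeylAlgebra.IsHolonomic K n M ↔ φ.totalDegree = n) := by
  have hf0 := Submodule.exists_ne_zero_of_span_eq_top hf
  obtain ⟨a, hφ⟩ := WeylAlgebra.exists_isDimensionPolynomial K b f
  set φ := binomCombination (fun i => 2 * blockSize b i) a with hφ_def
  have hdim : ∃ s : Fin p → ℤ, ∀ r : Fin p → ℤ, s ≤ r →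
      Module.Finite K ↥(WeylAlgebra.multiM K b f r) ∧
      MvPolynomial.eval (fun i => (r i : ℚ)) φ =
        (Module.finrank K ↥(WeylAlgebra.multiM K b f r) : ℚ) := by
    obtain ⟨s, hs⟩ := hφ
    refine ⟨fun i => s i, fun r hr => ?_⟩
    -- The threshold is nonnegative, so only natural `r` occur.
    obtain ⟨r, rfl⟩ : ∃ r' : Fin p → ℕ, r = fun i => (r' i : ℤ) :=
      ⟨fun i => (r i).toNat, funext fun i =>
        (Int.toNat_of_nonneg ((Int.natCast_nonneg _).trans (hr i))).symm⟩
    rw [WeylAlgebra.multiM_eq_moduleFiltration]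
    refine ⟨inferInstance, ?_⟩
    simp only [Int.cast_natCast]
    exact hs r fun i => Nat.cast_le.1 (hr i)
  refine ⟨φ, hφ.ne_zero hf0, ?_, hdim,
    fun i => ⟨hφ.blockSize_le_degreeOf hf0 i, degreeOf_binomCombination_le _ a i⟩,
    ⟨hφ.le_totalDegree hf0, ?_⟩, ⟨a, rfl⟩, ?_⟩
  · obtain ⟨s, hs⟩ := hdim
    exact ⟨s, fun r hr => ⟨_, (hs r hr).2.trans (Int.cast_natCast _).symm⟩⟩
  · refine (totalDegree_binomCombination_le _ a).trans ?_
    rw [← Finset.mul_sum, WeylAlgebra.sum_blockSize]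
  · constructor
    · rintro ⟨q, g, hg, ψ, hψ, hdeg⟩
      rw [hφ.totalDegree_eq hf hg hψ]
      exact Polynomial.natDegree_eq_of_degree_eq_some hdeg
    · intro hn
      obtain ⟨ψ, hψ⟩ := WeylAlgebra.exists_isBernsteinPolynomial K (n := n) f
      refine ⟨m, f, hf, ψ, hψ, ?_⟩
      -- Holonomicity is stated with `degree`, which is `⊥` for the zero polynomial; positive
      -- dimensions exclude this case.
      have hψ0 : ψ ≠ 0 := by
        rintro rfl
        obtain ⟨r₀, h⟩ := hψ
        have := h r₀.toNat (Int.self_le_toNat r₀)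
        rw [WeylAlgebra.bernstein_eq_moduleFiltration, Polynomial.eval_zero, eq_comm,
          Nat.cast_eq_zero] at this
        exact (WeylAlgebra.finrank_moduleFiltration_pos K _ hf0 _).ne' this
      rw [Polynomial.degree_eq_natDegree hψ0, ← hφ.totalDegree_eq hf hf hψ, hn]
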